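/- Let $a>0$ and let $v\in L^\infty(a,\infty)$ be real-valued with $|v(x)|=o(x^{-2})$ as $x\to+\infty$. For each $h>0$ let $T_h$ be the self-adjoint operator in the complex Hilbert space $L^2(a,\infty)$ acting by \[ (T_hu)(x)=-h^2u''(x)+\Big(-\frac{1}{4x^2}+v(x)\Big)u(x) \] with any self-adjoint boundary condition at $a$ (possibly depending on $h$); that is, $T_h$ is any self-adjoint operator whose domain consists of functions $u\in L^2(a,\infty)$ such that $u$ and $u'$ are locally absolutely continuous on $[a,\infty)$ and $u''\in L^2(a,\infty)$, and which acts by the above formula. For a self-adjoint operator $T$ and $E\in\mathbb R$, let $\mathcal N(T,E)$ denote the dimension of the range of the spectral projector of $T$ on $(-\infty,E)$. Let $\gamma\in(0,2)$ and $C>0$. Then, for every $h>0$, $\mathcal N(T_h,-Ch^\gamma)$ is finite and equals the number of eigenvalues of $T_h$ in $(-\infty,-Ch^\gamma)$, counted with multiplicities, and \[ \mathcal N\big(T_h,-Ch^\gamma\big)\sim\frac{\gamma}{4\pi}\,\frac{|\log h|}{h}\qquad\text{as } h\to0^+ , \] i.e. the ratio of the two sides tends to $1$. -/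

import Mathlib

open MeasureTheory Set Filter Topology Asymptotics

noncomputable section

/-- The complex Hilbert space `L²(a, ∞)`. -/
abbrev HalfLineL2 (a : ℝ) : Type := Lp ℂ 2 (volume.restrict (Ioi a))

/-- `u ∈ L²(a, ∞)` has the second derivative `w ∈ L²(a, ∞)`: up to a null set, `u` is a function `g`
such that `g` and `g' = p` are locally absolutely continuous on `[a, ∞)` and `p' = w` a.e. -/
def HasSecondDerivL2 (a : ℝ) (u w : HalfLineL2 a) : Prop :=
  ∃ g p : ℝ → ℂ,
    (u =ᵐ[volume.restrict (Ioi a)] g) ∧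
    (∀ x, a ≤ x → g x = g a + ∫ t in a..x, p t) ∧
    (∀ x, a ≤ x → p x = p a + ∫ t in a..x, w t)

/-- `T` is a self-adjoint operator in `L²(a, ∞)` acting by `T u = -h² u'' + V u`, that is, the
realization of this differential expression given by some self-adjoint boundary condition at `a`:
a self-adjoint restriction of the maximal operator. (For bounded `V` and `h ≠ 0` no
condition at infinity occurs, and these are exactly the operators whose domain consists of all
`u ∈ H²(a, ∞)` with `cos θ * u(a) + sin θ * u'(a) = 0` for some real `θ`.) -/
def IsSchrodingerRealization (a h : ℝ) (V : ℝ → ℝ)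
    (T : HalfLineL2 a →ₗ.[ℂ] HalfLineL2 a) : Prop :=
  IsSelfAdjoint T ∧
  ∀ u : T.domain, ∃ w : HalfLineL2 a, HasSecondDerivL2 a (u : HalfLineL2 a) w ∧
    (T u =ᵐ[volume.restrict (Ioi a)]
      fun x => -((h : ℂ) ^ 2) * w x + (V x : ℂ) * (u : HalfLineL2 a) x)

section Counting

variable {H : Type*} [NormedAddCommGroup H] [InnerProductSpace ℂ H] [CompleteSpace H]

/-- `P` is the spectral projector of the self-adjoint operator `T` on `(-∞, E)`: the (unique)
orthogonal projector that commutes with `T`, such that `T < E` on the range of `P` and `T ≥ E` on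
its orthogonal complement. -/
def IsSpectralProjectorBelow (T : H →ₗ.[ℂ] H) (E : ℝ) (P : H →L[ℂ] H) : Prop :=
  IsStarProjection P ∧
  (∀ u : T.domain, ∃ y : T.domain, (y : H) = P u ∧ T y = P (T u)) ∧
  (∀ u : T.domain, P u = u → (u : H) ≠ 0 →
    (inner ℂ (T u) (u : H)).re < E * ‖(u : H)‖ ^ 2) ∧
  (∀ u : T.domain, P u = 0 → E * ‖(u : H)‖ ^ 2 ≤ (inner ℂ (T u) (u : H)).re)

/-- The counting function `𝓝(T, E)`: the dimension of the range of the spectral projector of the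
self-adjoint operator `T` on `(-∞, E)`. The supremum is over the one spectral projector. -/
def countingFunction (T : H →ₗ.[ℂ] H) (E : ℝ) : ℕ∞ :=
  ⨆ (P : H →L[ℂ] H) (_ : IsSpectralProjectorBelow T E P),
    Cardinal.toENat (Module.rank ℂ (LinearMap.range (P : H →ₗ[ℂ] H)))

/-- The eigenspace `ker (T - lam)` of an unbounded operator `T` (zero if `lam` is not an
eigenvalue). -/
def opEigenspace (T : H →ₗ.[ℂ] H) (lam : ℝ) : Submodule ℂ H where
  carrier := {x | ∃ u : T.domain, (u : H) = x ∧ T u = (lam : ℂ) • x}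
  zero_mem' := ⟨0, by simp⟩
  add_mem' := by
    rintro _ _ ⟨u, rfl, hu⟩ ⟨w, rfl, hw⟩
    exact ⟨u + w, by simp, by rw [T.map_add, hu, hw, smul_add]⟩
  smul_mem' := by
    rintro c _ ⟨u, rfl, hu⟩
    exact ⟨c • u, by simp, by rw [T.map_smul, hu, smul_comm]⟩

/-- The number of eigenvalues of `T` in `(-∞, E)`, counted with multiplicities. -/
def eigenvalueCount (T : H →ₗ.[ℂ] H) (E : ℝ) : ℕ∞ :=
  Cardinal.toENat (Cardinal.sum fun lam : Iio E => Module.rank ℂ (opEigenspace T lam))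

end Counting

end

/-!
The number of eigenvalues of `T h` below `E = -C h ^ γ` is compared with explicitly solvable inverse
square potentials, on which `√x * sin (κ * log x + θ)` solves `-y'' = (κ² + 1/4) / x² * y` and has a
zero in every interval of logarithmic length `π / κ`. For `x` between a constant and the scale
`h ^ (-γ/2)`, where `1 / x²` and `h ^ γ` are comparable, the potential minus `E` is close to
`-1 / (4 x²)`, so `κ` is close to `1 / (2h)`, and the interval of logarithmic length about
`(γ/2) |log h|` has about `γ |log h| / (4πh)` zeros. On the remaining bounded interval the potential
is bounded and contributes `O(1 / h)`; beyond that scale the potential exceeds `E`.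

*Upper bound.* Let `u` in the domain vanish at `a` and at the zeros. By Picone's identity
(`hardy_between_zeros`) the form of `T h - E` at `u` is nonnegative (`form_nonneg_halfLine`); the
boundary condition at `a` does not matter because `u` vanishes there. So the form is at least `E` on
the common kernel of finitely many linear functionals
(`IsSchrodingerRealization.hasFormIndexLE`).

*Lower bound.* A compactly supported `H²` function on `(a, ∞)` lies in the domain of the adjoint of
`T h`, which is `T h` (`IsSchrodingerRealization.exists_trial`). Smoothing the first-order zeros of
the comparison solution gives disjointly supported trial functions with energy below `E`
(`exists_trial_profile`, `IsSchrodingerRealization.le_countingFunction`).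

*The spectral projector.* For any self-adjoint `T` whose form is at least `E` on the kernel of
finitely many functionals, the spectral projector on `(-∞, E)` is obtained from the resolvent: the
bounded operator `K = Re (T - E + i)⁻¹` has the sign of `T - E`, and the range of its negative part
is finite dimensional (`IsSelfAdjoint.exists_isSpectralProjectorBelow`). Any operator with the
defining properties of the spectral projector has finite dimensional range contained in the domain,
and this range is the direct sum of the eigenspaces below `E`
(`IsSpectralProjectorBelow.rank_range_eq`). Hence the counting function is the number of
eigenvalues, and it obeys the variational bounds.
-/

/-! ### Self-adjoint operators and their resolvents -/

section Abstract

variable {H : Type*} [NormedAddCommGroup H] [InnerProductSpace ℂ H] [CompleteSpace H]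
  {T : H →ₗ.[ℂ] H}

theorem IsSelfAdjoint.pmap_inner_apply (hT : IsSelfAdjoint T) (u v : T.domain) :
    inner ℂ (T u) (v : H) = inner ℂ (u : H) (T v) := by
  have h := LinearPMap.adjoint_isFormalAdjoint hT.dense_domain
  rw [LinearPMap.isSelfAdjoint_def.mp hT] at h
  exact h u v

/-- Every weak solution of `T u = ψ` lies in the domain, which is that of the adjoint. -/
theorem IsSelfAdjoint.pmap_exists_eq (hT : IsSelfAdjoint T) {φ ψ : H}
    (h : ∀ u : T.domain, inner ℂ ψ (u : H) = inner ℂ φ (T u)) :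
    ∃ u : T.domain, (u : H) = φ ∧ T u = ψ := by
  have hmem := LinearPMap.mem_adjoint_domain_of_exists (T := T) φ ⟨ψ, h⟩
  have happ := LinearPMap.adjoint_apply_eq hT.dense_domain ⟨φ, hmem⟩ h
  have hg : (φ, ψ) ∈ T.adjoint.graph := by
    rw [LinearPMap.mem_graph_iff]
    exact ⟨⟨φ, hmem⟩, rfl, happ⟩
  rw [LinearPMap.isSelfAdjoint_def.mp hT, LinearPMap.mem_graph_iff] at hg
  exact hg

theorem IsSelfAdjoint.pmap_inner_im (hT : IsSelfAdjoint T) (u : T.domain) :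
    (inner ℂ (u : H) (T u)).im = 0 := by
  have h := inner_conj_symm (𝕜 := ℂ) (u : H) (T u)
  rw [hT.pmap_inner_apply] at h
  exact Complex.conj_eq_iff_im.mp h

theorem IsSelfAdjoint.abs_im_mul_norm_le (hT : IsSelfAdjoint T) (z : ℂ) (u : T.domain) :
    |z.im| * ‖(u : H)‖ ≤ ‖T u - z • (u : H)‖ := by
  rcases eq_or_ne (u : H) 0 with h0 | h0
  · simp [h0]
  have hpos : 0 < ‖(u : H)‖ := norm_pos_iff.mpr h0
  have him : (inner ℂ (u : H) (T u - z • (u : H))).im = -(z.im * ‖(u : H)‖ ^ 2) := by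
    rw [inner_sub_right, inner_smul_right, inner_self_eq_norm_sq_to_K, Complex.sub_im,
      hT.pmap_inner_im]
    simp [← Complex.ofReal_pow]
  have h1 : |z.im| * ‖(u : H)‖ ^ 2 ≤ ‖(u : H)‖ * ‖T u - z • (u : H)‖ := by
    calc |z.im| * ‖(u : H)‖ ^ 2 = |(inner ℂ (u : H) (T u - z • (u : H))).im| := by
          rw [him, abs_neg, abs_mul, abs_of_nonneg (sq_nonneg ‖(u : H)‖)]
      _ ≤ ‖inner ℂ (u : H) (T u - z • (u : H))‖ := Complex.abs_im_le_norm _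
      _ ≤ _ := norm_inner_le_norm _ _
  nlinarith

/-- `T - z` as a linear map on the domain of `T`. -/
noncomputable def shiftedMap (T : H →ₗ.[ℂ] H) (z : ℂ) : T.domain →ₗ[ℂ] H :=
  T.toFun - z • T.domain.subtype

omit [CompleteSpace H] in
theorem shiftedMap_apply (z : ℂ) (u : T.domain) : shiftedMap T z u = T u - z • (u : H) := rfl

/-- The range is closed because `T` is closed and `T - z` is bounded below; its orthogonal
complement is the kernel of `T - conj z`, which is trivial. -/
theorem IsSelfAdjoint.shiftedMap_range (hT : IsSelfAdjoint T) {z : ℂ} (hz : z.im ≠ 0) :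
    LinearMap.range (shiftedMap T z) = ⊤ := by
  have hclosed : IsClosed (LinearMap.range (shiftedMap T z) : Set H) := by
    refine isClosed_of_closure_subset fun y hy => ?_
    obtain ⟨s, hs, hlim⟩ := mem_closure_iff_seq_limit.mp hy
    choose u hu using hs
    have hcau : CauchySeq fun n => ((u n : T.domain) : H) := by
      have hb : ∀ m n, ‖(u m : H) - (u n : H)‖ ≤ |z.im|⁻¹ * ‖s m - s n‖ := by
        intro m n
        have h := hT.abs_im_mul_norm_le z (u m - u n)
        rw [← shiftedMap_apply, map_sub, hu, hu] at h
        rw [← div_eq_inv_mul, le_div_iff₀ (abs_pos.mpr hz), mul_comm]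
        exact_mod_cast h
      rw [Metric.cauchySeq_iff]
      intro ε hε
      obtain ⟨N, hN⟩ := Metric.cauchySeq_iff.mp hlim.cauchySeq (|z.im| * ε)
        (mul_pos (abs_pos.mpr hz) hε)
      refine ⟨N, fun m hm n hn => ?_⟩
      have h1 := hN m hm n hn
      rw [dist_eq_norm] at h1 ⊢
      refine (hb m n).trans_lt ?_
      rw [← div_eq_inv_mul, div_lt_iff₀ (abs_pos.mpr hz), mul_comm]
      exact h1
    obtain ⟨x, hx⟩ := cauchySeq_tendsto_of_complete hcau
    have hTu : Tendsto (fun n => T (u n)) atTop (𝓝 (y + z • x)) := by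
      refine (hlim.add (hx.const_smul z)).congr fun n => ?_
      rw [← hu n, shiftedMap_apply, sub_add_cancel]
    have hg : (x, y + z • x) ∈ (T.graph : Set (H × H)) :=
      hT.isClosed.mem_of_tendsto (hx.prodMk_nhds hTu)
        (Eventually.of_forall fun n => T.mem_graph (u n))
    obtain ⟨v, hv1, hv2⟩ := (LinearPMap.mem_graph_iff T).mp hg
    refine ⟨v, ?_⟩
    rw [shiftedMap_apply, hv2, hv1, add_sub_cancel_right]
  rw [← hclosed.submodule_topologicalClosure_eq, Submodule.topologicalClosure_eq_top_iff,
    Submodule.eq_bot_iff]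
  intro y hy
  have horth : ∀ u : T.domain, inner ℂ ((starRingEnd ℂ) z • y) (u : H) = inner ℂ y (T u) := by
    intro u
    have h := (Submodule.mem_orthogonal' _ y).mp hy _ ⟨u, rfl⟩
    rw [shiftedMap_apply, inner_sub_right, sub_eq_zero] at h
    rw [h, inner_smul_left, inner_smul_right, Complex.conj_conj]
  obtain ⟨v, hv, hTv⟩ := hT.pmap_exists_eq horth
  have h := hT.abs_im_mul_norm_le ((starRingEnd ℂ) z) v
  rw [hTv, hv, sub_self, norm_zero, Complex.conj_im, abs_neg] at h
  have h2 : ‖y‖ ≤ 0 := by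
    by_contra hc
    exact absurd h (not_le.mpr (mul_pos (abs_pos.mpr hz) (not_le.mp hc)))
  exact norm_le_zero_iff.mp h2

/-- The resolvent: off the real axis `T - z` has a bounded everywhere defined inverse. -/
theorem IsSelfAdjoint.exists_resolvent (hT : IsSelfAdjoint T) {z : ℂ} (hz : z.im ≠ 0) :
    ∃ R : H →L[ℂ] H, (∀ y, ∃ u : T.domain, (u : H) = R y ∧ T u - z • (u : H) = y) ∧
      ∀ u : T.domain, R (T u - z • (u : H)) = u := by
  have hinj : Function.Injective (shiftedMap T z) := by
    refine (injective_iff_map_eq_zero _).mpr fun u hu => ?_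
    have h := hT.abs_im_mul_norm_le z u
    rw [← shiftedMap_apply, hu, norm_zero] at h
    have h2 : ‖(u : H)‖ ≤ 0 := by
      by_contra hc
      exact absurd h (not_le.mpr (mul_pos (abs_pos.mpr hz) (not_le.mp hc)))
    exact Subtype.ext (norm_le_zero_iff.mp h2)
  let e := LinearEquiv.ofBijective (shiftedMap T z)
    ⟨hinj, LinearMap.range_eq_top.mp (hT.shiftedMap_range hz)⟩
  have he : ∀ u, e u = T u - z • (u : H) := fun u => rfl
  refine ⟨(T.domain.subtype ∘ₗ e.symm.toLinearMap).mkContinuous |z.im|⁻¹ fun y => ?_,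
    fun y => ⟨e.symm y, rfl, ?_⟩, fun u => ?_⟩
  · have h := hT.abs_im_mul_norm_le z (e.symm y)
    rw [← he, LinearEquiv.apply_symm_apply] at h
    rw [← div_eq_inv_mul, le_div_iff₀ (abs_pos.mpr hz), mul_comm]
    exact h
  · rw [← he, LinearEquiv.apply_symm_apply]
  · rw [← he]
    simp

/-- The hypothesis of the variational bounds: on the common kernel of some `M` linear functionals
on the domain of `T`, which need not be continuous, the form of `T` is at least `E`. -/
def HasFormIndexLE (T : H →ₗ.[ℂ] H) (E : ℝ) (M : ℕ) : Prop :=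
  ∃ l : T.domain →ₗ[ℂ] (Fin M → ℂ), ∀ u : T.domain, l u = 0 →
    E * ‖(u : H)‖ ^ 2 ≤ (inner ℂ (T u) (u : H)).re

omit [CompleteSpace H] in
/-- The form of `T` is below `E` on no subspace of dimension greater than `M`. -/
theorem HasFormIndexLE.rank_le {E : ℝ} {M : ℕ} (hM : HasFormIndexLE T E M) {W : Type*}
    [AddCommGroup W] [Module ℂ W] (L : W →ₗ[ℂ] T.domain)
    (hL : ∀ y : W, y ≠ 0 → (inner ℂ (T (L y)) (L y : H)).re < E * ‖(L y : H)‖ ^ 2) :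
    Module.rank ℂ W ≤ M := by
  obtain ⟨l, hl⟩ := hM
  have hinj : Function.Injective (l ∘ₗ L) := by
    refine (injective_iff_map_eq_zero _).mpr fun y hy => ?_
    by_contra hne
    exact absurd (hl (L y) hy) (not_le.mpr (hL y hne))
  simpa using LinearMap.lift_rank_le_of_injective _ hinj

theorem ContinuousLinearMap.apply_eq_zero_of_inner_eq_zero {N : H →L[ℂ] H} (hN : 0 ≤ N) {x : H}
    (hx : (inner ℂ x (N x)).re = 0) : N x = 0 := by
  have hsq : CFC.sqrt N * CFC.sqrt N = N := CFC.sqrt_mul_sqrt_self N hN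
  have hsa : star (CFC.sqrt N) = CFC.sqrt N :=
    (IsSelfAdjoint.of_nonneg (CFC.sqrt_nonneg N)).star_eq
  have h1 : N x = CFC.sqrt N (CFC.sqrt N x) := by
    conv_lhs => rw [← hsq]
    rfl
  have h2 : inner ℂ x (N x) = inner ℂ (CFC.sqrt N x) (CFC.sqrt N x) := by
    rw [h1, ← ContinuousLinearMap.adjoint_inner_left, ← ContinuousLinearMap.star_eq_adjoint, hsa]
  rw [h2, inner_self_eq_norm_sq_to_K] at hx
  have h3 : CFC.sqrt N x = 0 := by
    have : ‖CFC.sqrt N x‖ ^ 2 = 0 := by exact_mod_cast hx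
    simpa using this
  rw [h1, h3, map_zero]

omit [CompleteSpace H] in
theorem ContinuousLinearMap.inner_nonneg_of_nonneg {N : H →L[ℂ] H} (hN : 0 ≤ N) (x : H) :
    0 ≤ (inner ℂ x (N x)).re := by
  have h := (ContinuousLinearMap.nonneg_iff_isPositive N).mp hN
  have := h.inner_nonneg_right x
  exact (Complex.le_def.mp this).1

end Abstract

/-! ### The spectral projector below a point -/

section Projector

variable {H : Type*} [NormedAddCommGroup H] [InnerProductSpace ℂ H] [CompleteSpace H]
  {T : H →ₗ.[ℂ] H}

theorem IsSelfAdjoint.adjoint_resolvent (hT : IsSelfAdjoint T) {z : ℂ} {R S : H →L[ℂ] H}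
    (hR : ∀ y, ∃ u : T.domain, (u : H) = R y ∧ T u - z • (u : H) = y)
    (hS : ∀ y, ∃ u : T.domain, (u : H) = S y ∧ T u - (starRingEnd ℂ z) • (u : H) = y) :
    star R = S := by
  rw [ContinuousLinearMap.star_eq_adjoint]
  symm
  rw [ContinuousLinearMap.eq_adjoint_iff]
  intro x y
  obtain ⟨u, hu, hu'⟩ := hS x
  obtain ⟨v, hv, hv'⟩ := hR y
  rw [← hu, ← hv]
  conv_lhs => rw [← hv']
  conv_rhs => rw [← hu']
  rw [inner_sub_right, inner_sub_left, hT.pmap_inner_apply, inner_smul_left, inner_smul_right,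
    Complex.conj_conj]

omit [CompleteSpace H] in
theorem resolvent_identity {z w : ℂ} {R S : H →L[ℂ] H}
    (hR : ∀ u : T.domain, R (T u - z • (u : H)) = u)
    (hS : ∀ y, ∃ u : T.domain, (u : H) = S y ∧ T u - w • (u : H) = y) (y : H) :
    S y - R y = (w - z) • R (S y) := by
  obtain ⟨u, hu, hu'⟩ := hS y
  have h := hR u
  rw [← hu]
  have h1 : T u - z • (u : H) = y + (w - z) • (u : H) := by
    rw [← hu', sub_smul]; abel
  rw [h1, map_add, map_smul] at h
  rw [sub_eq_iff_eq_add, add_comm]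
  exact h.symm

/-- If the form of `T` is at least `E` on a subspace of finite codimension, then the spectral
projector of `T` on `(-∞, E)` exists. It is the orthogonal projector on the range of the negative
part of the bounded operator `Re (T - E + i)⁻¹ = (T - E) / ((T - E)² + 1)`, which has the sign of
`T - E`. -/
theorem IsSelfAdjoint.exists_isSpectralProjectorBelow (hT : IsSelfAdjoint T) {E : ℝ} {M : ℕ}
    (hM : HasFormIndexLE T E M) : ∃ P : H →L[ℂ] H, IsSpectralProjectorBelow T E P := by
  obtain ⟨R, hR, hR'⟩ := hT.exists_resolvent (z := E - Complex.I) (by simp)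
  obtain ⟨S, hS, hS'⟩ := hT.exists_resolvent (z := E + Complex.I) (by simp)
  have hconj : (starRingEnd ℂ) ((E : ℂ) - Complex.I) = E + Complex.I := by simp
  have hstar : star R = S := hT.adjoint_resolvent hR (by rw [hconj]; exact hS)
  have hstar' : star S = R := by rw [← hstar, star_star]
  have hcomm : Commute R S := by
    ext y
    have h1 := resolvent_identity hR' hS y
    have h2 := resolvent_identity hS' hR y
    have h3 : (2 * Complex.I) • R (S y) = (2 * Complex.I) • S (R y) := by
      have e1 : (E : ℂ) + Complex.I - (E - Complex.I) = 2 * Complex.I := by ring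
      have e2 : (E : ℂ) - Complex.I - (E + Complex.I) = -(2 * Complex.I) := by ring
      rw [e1] at h1
      rw [e2, neg_smul] at h2
      rw [← h1, ← neg_eq_iff_eq_neg.mpr h2, neg_sub]
    exact smul_right_injective H (by simp : (2 * Complex.I) ≠ 0) h3
  set K : H →L[ℂ] H := R + S with hK
  have hKsa : IsSelfAdjoint K := by
    rw [IsSelfAdjoint, hK, star_add, hstar, hstar', add_comm]
  have hKR : Commute K R := (Commute.refl R).add_left hcomm.symm
  have hKS : Commute K S := hcomm.add_left (Commute.refl S)
  set N : H →L[ℂ] H := K⁻ with hN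
  have hNR : Commute N R := by
    rw [hN, CFC.negPart_def]; exact hKR.cfcₙ_real _
  have hNS : Commute N S := by
    rw [hN, CFC.negPart_def]; exact hKS.cfcₙ_real _
  have hN0 : 0 ≤ N := CFC.negPart_nonneg K
  have hNsa : star N = N := (IsSelfAdjoint.of_nonneg hN0).star_eq
  have hNadj : ∀ x y, inner ℂ (N x) y = inner ℂ x (N y) := fun x y => by
    conv_lhs => rw [← hNsa]
    rw [ContinuousLinearMap.star_eq_adjoint, ContinuousLinearMap.adjoint_inner_left]
  have hKN : K = K⁺ - N := (CFC.posPart_sub_negPart K hKsa).symm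
  have hPN : K⁺ * N = 0 := CFC.posPart_mul_negPart K
  -- The form of `T - E` at `R y` is half the form of `K` at `y`.
  have hform : ∀ u : T.domain, (inner ℂ (T u) (u : H)).re - E * ‖(u : H)‖ ^ 2 =
      (inner ℂ (T u - ((E : ℂ) - Complex.I) • (u : H))
        (K (T u - ((E : ℂ) - Complex.I) • (u : H)))).re / 2 := by
    intro u
    set y := T u - ((E : ℂ) - Complex.I) • (u : H) with hy
    have hRy : R y = u := hR' u
    have e1 : (inner ℂ y (S y)).re = (inner ℂ y (R y)).re := by
      rw [← hstar, ContinuousLinearMap.star_eq_adjoint, ContinuousLinearMap.adjoint_inner_right,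
        ← inner_conj_symm, Complex.conj_re]
    have e2 : (inner ℂ y (K y)).re = 2 * (inner ℂ y (R y)).re := by
      rw [hK, add_apply, inner_add_right, Complex.add_re, e1]; ring
    rw [e2, hRy, hy, inner_sub_left, inner_smul_left, inner_self_eq_norm_sq_to_K]
    simp [← Complex.ofReal_pow]
  set W : Submodule ℂ H := LinearMap.range (N : H →ₗ[ℂ] H) with hW
  have hNW : ∀ x, N x ∈ W := fun x => ⟨x, rfl⟩
  have hneg : ∀ y ∈ W, y ≠ 0 → (inner ℂ y (K y)).re < 0 := by
    rintro _ ⟨x, rfl⟩ hne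
    have hne : N x ≠ 0 := hne
    change (inner ℂ (N x) (K (N x))).re < 0
    have h1 : K (N x) = -N (N x) := by
      rw [hKN, sub_apply]
      have : K⁺ (N x) = 0 := congrArg (fun A : H →L[ℂ] H => A x) hPN
      rw [this, zero_sub]
    rw [h1, inner_neg_right, Complex.neg_re, neg_lt_zero]
    refine lt_of_le_of_ne (ContinuousLinearMap.inner_nonneg_of_nonneg hN0 _) fun h => hne ?_
    have h2 := ContinuousLinearMap.apply_eq_zero_of_inner_eq_zero hN0 h.symm
    rw [← inner_self_eq_zero (𝕜 := ℂ), hNadj, h2, inner_zero_right]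
  have hformR : ∀ u : T.domain, T u - ((E : ℂ) - Complex.I) • (u : H) ∈ W → (u : H) ≠ 0 →
      (inner ℂ (T u) (u : H)).re < E * ‖(u : H)‖ ^ 2 := by
    intro u hu hne
    have h := hform u
    have hy : T u - ((E : ℂ) - Complex.I) • (u : H) ≠ 0 := fun h0 => hne (by
      rw [← hR' u, h0, map_zero])
    have := hneg _ hu hy
    linarith
  have hrank : Module.rank ℂ W ≤ M := by
    choose L hL hL' using hR
    let L' : W →ₗ[ℂ] T.domain :=
      LinearMap.codRestrict T.domain ((R : H →ₗ[ℂ] H) ∘ₗ W.subtype) fun y => by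
        change R y ∈ T.domain
        rw [← hL]; exact (L y).2
    refine hM.rank_le L' fun y hy => ?_
    have hLy : L' y = L y := Subtype.ext (hL y).symm
    have hy' : T (L' y) - ((E : ℂ) - Complex.I) • (L' y : H) = y := by rw [hLy]; exact hL' y
    refine hformR _ (by rw [hy']; exact y.2) fun h0 => hy ?_
    have hL0 : L' y = 0 := Subtype.ext h0
    rw [hL0] at hy'
    apply Subtype.ext
    rw [← hy']
    simp
  have : FiniteDimensional ℂ W := Module.rank_lt_aleph0_iff.mp <|
    hrank.trans_lt (Cardinal.natCast_lt_aleph0)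
  have hmapW : ∀ (B : H →L[ℂ] H), Commute N B → ∀ y ∈ W, B y ∈ W := by
    rintro B hB _ ⟨x, rfl⟩
    exact ⟨B x, congrArg (fun A : H →L[ℂ] H => A x) hB.eq⟩
  have hmapWo : ∀ y ∈ Wᗮ, R y ∈ Wᗮ := by
    intro y hy
    rw [Submodule.mem_orthogonal] at hy ⊢
    intro w hw
    rw [← hstar', ContinuousLinearMap.star_eq_adjoint, ContinuousLinearMap.adjoint_inner_right]
    exact hy _ (hmapW S hNS w hw)
  have hPR : ∀ y, W.starProjection (R y) = R (W.starProjection y) := by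
    intro y
    refine Submodule.eq_starProjection_of_mem_orthogonal
      (hmapW R hNR _ (Submodule.starProjection_apply_mem _ _)) ?_
    rw [← map_sub]
    exact hmapWo _ (Submodule.sub_starProjection_mem_orthogonal _)
  refine ⟨W.starProjection, isStarProjection_starProjection, fun u => ?_, fun u hu hne => ?_,
    fun u hu => ?_⟩
  · set y := T u - ((E : ℂ) - Complex.I) • (u : H) with hy
    obtain ⟨w, hw, hw'⟩ := hR (W.starProjection y)
    have h1 : (w : H) = W.starProjection u := by rw [hw, ← hPR, hR' u]
    refine ⟨w, h1, ?_⟩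
    rw [sub_eq_iff_eq_add.mp hw', h1, hy, map_sub, map_smul, sub_add_cancel]
  · refine hformR u ?_ hne
    rw [← Submodule.starProjection_eq_self_iff]
    set y := T u - ((E : ℂ) - Complex.I) • (u : H) with hy
    have h1 : R (W.starProjection y) = R y := by rw [← hPR, hR', hu]
    obtain ⟨w, hw, hw'⟩ := hR (W.starProjection y)
    obtain ⟨w₂, hw₂, hw₂'⟩ := hR y
    have : w = w₂ := Subtype.ext (by rw [hw, hw₂, h1])
    rw [← hw', ← hw₂', this]
  · have h := hform u
    set y := T u - ((E : ℂ) - Complex.I) • (u : H) with hy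
    have h1 : R (W.starProjection y) = 0 := by rw [← hPR, hR', hu]
    obtain ⟨w, hw, hw'⟩ := hR (W.starProjection y)
    have hw0 : w = 0 := Subtype.ext (by rw [hw, h1]; rfl)
    have hPy : W.starProjection y = 0 := by rw [← hw', hw0]; simp
    have hyo : y ∈ Wᗮ := (Submodule.starProjection_apply_eq_zero_iff _).mp hPy
    have hNy : N y = 0 := by
      rw [← inner_self_eq_zero (𝕜 := ℂ), hNadj]
      exact (Submodule.mem_orthogonal' _ _).mp hyo _ (hNW _)
    have hKy : K y = K⁺ y := by
      conv_lhs => rw [hKN]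
      rw [sub_apply, hNy, sub_zero]
    rw [hKy] at h
    have := ContinuousLinearMap.inner_nonneg_of_nonneg (CFC.posPart_nonneg K) y
    linarith

namespace IsSpectralProjectorBelow

variable {E : ℝ} {P : H →L[ℂ] H}

theorem apply_apply (hP : IsSpectralProjectorBelow T E P) (x : H) : P (P x) = P x :=
  congrArg (fun A : H →L[ℂ] H => A x) hP.1.isIdempotentElem.eq

omit [CompleteSpace H] in
theorem mem_range_iff {P : H →L[ℂ] H} (hP : ∀ x, P (P x) = P x) {x : H} :
    x ∈ LinearMap.range (P : H →ₗ[ℂ] H) ↔ P x = x :=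
  ⟨by rintro ⟨y, rfl⟩; exact hP y, fun h => ⟨x, h⟩⟩

/-- The range of the spectral projector lies in the domain: the image of the dense domain is dense
in it, and finite dimensional by the variational hypothesis. -/
theorem range_le_domain_and_rank_le (hT : IsSelfAdjoint T) (hP : IsSpectralProjectorBelow T E P)
    {M : ℕ} (hM : HasFormIndexLE T E M) :
    LinearMap.range (P : H →ₗ[ℂ] H) ≤ T.domain ∧
      Module.rank ℂ (LinearMap.range (P : H →ₗ[ℂ] H)) ≤ M := by
  have hPP := hP.apply_apply
  set D : Submodule ℂ H := T.domain.map (P : H →ₗ[ℂ] H) with hD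
  have hDdom : D ≤ T.domain := by
    rintro _ ⟨x, hx, rfl⟩
    obtain ⟨y, hy, -⟩ := hP.2.1 ⟨x, hx⟩
    change P x ∈ T.domain
    rw [← hy]; exact y.2
  have hDP : ∀ x ∈ D, P x = x := by
    rintro _ ⟨x, hx, rfl⟩
    exact hPP x
  have hrank : Module.rank ℂ D ≤ M := by
    refine hM.rank_le (Submodule.inclusion hDdom) fun y hy => ?_
    exact hP.2.2.1 (Submodule.inclusion hDdom y) (hDP y y.2) fun h0 => hy (Subtype.ext h0)
  have : FiniteDimensional ℂ D := Module.rank_lt_aleph0_iff.mp <|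
    hrank.trans_lt (Cardinal.natCast_lt_aleph0)
  have hclosed : IsClosed (D : Set H) := D.closed_of_finiteDimensional
  have hle : LinearMap.range (P : H →ₗ[ℂ] H) ≤ D := by
    rintro _ ⟨x, rfl⟩
    have hx : x ∈ closure (T.domain : Set H) := hT.dense_domain x
    have h1 : P x ∈ closure (P '' (T.domain : Set H)) :=
      image_closure_subset_closure_image P.continuous ⟨x, hx, rfl⟩
    exact hclosed.closure_subset_iff.mpr (fun _ h => h) h1
  exact ⟨hle.trans hDdom, (Submodule.rank_mono hle).trans hrank⟩

/-- An eigenvector below `E` has no component orthogonal to the range of the projector, since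
this component would be an eigenvector on which the form is at least `E`. -/
theorem opEigenspace_le_range (hP : IsSpectralProjectorBelow T E P) {lam : ℝ} (hlam : lam < E) :
    opEigenspace T lam ≤ LinearMap.range (P : H →ₗ[ℂ] H) := by
  rintro _ ⟨u, rfl, hu⟩
  obtain ⟨y, hy, hTy⟩ := hP.2.1 u
  have hPP := hP.apply_apply
  have h1 : P ((u - y : T.domain) : H) = 0 := by
    rw [Submodule.coe_sub, map_sub, hy, hPP, sub_self]
  have h2 : T (u - y) = (lam : ℂ) • ((u - y : T.domain) : H) := by
    rw [T.map_sub, hTy, hu, map_smul, ← hy, Submodule.coe_sub, smul_sub]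
  have h3 := hP.2.2.2 (u - y) h1
  rw [h2, inner_smul_left, inner_self_eq_norm_sq_to_K] at h3
  have h4 : E * ‖((u - y : T.domain) : H)‖ ^ 2 ≤ lam * ‖((u - y : T.domain) : H)‖ ^ 2 := by
    simpa [← Complex.ofReal_pow] using h3
  have h5 : ((u - y : T.domain) : H) = 0 := by
    by_contra hne
    have : 0 < ‖((u - y : T.domain) : H)‖ ^ 2 := by positivity
    nlinarith
  refine ⟨u, ?_⟩
  rw [Submodule.coe_sub, sub_eq_zero, hy] at h5
  exact h5.symm

theorem iSupIndep_opEigenspace (hT : IsSelfAdjoint T) (s : Set ℝ) :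
    iSupIndep fun lam : s => opEigenspace T lam := by
  refine OrthogonalFamily.independent (𝕜 := ℂ) (V := fun lam : s => opEigenspace T lam) ?_
  rintro ⟨l, hl⟩ ⟨m, hm⟩ hlm ⟨_, u, rfl, hu⟩ ⟨_, w, rfl, hw⟩
  have h := hT.pmap_inner_apply u w
  rw [hu, hw, inner_smul_left, inner_smul_right, Complex.conj_ofReal, ← sub_eq_zero, ← sub_mul,
    mul_eq_zero] at h
  refine h.resolve_left fun h0 => hlm ?_
  apply Subtype.ext
  exact_mod_cast sub_eq_zero.mp h0

/-- The range of the spectral projector is the direct sum of the eigenspaces below `E`. -/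
theorem iSup_opEigenspace (hT : IsSelfAdjoint T) (hP : IsSpectralProjectorBelow T E P)
    (hdom : LinearMap.range (P : H →ₗ[ℂ] H) ≤ T.domain)
    [FiniteDimensional ℂ (LinearMap.range (P : H →ₗ[ℂ] H))] :
    ⨆ lam : Iio E, opEigenspace T lam = LinearMap.range (P : H →ₗ[ℂ] H) := by
  have hPP := hP.apply_apply
  refine le_antisymm (iSup_le fun lam => hP.opEigenspace_le_range lam.2) ?_
  set W := LinearMap.range (P : H →ₗ[ℂ] H) with hW
  have hTW : ∀ y : W, T (Submodule.inclusion hdom y) ∈ W := by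
    intro y
    obtain ⟨w, hw, hTw⟩ := hP.2.1 (Submodule.inclusion hdom y)
    have hyw : w = Submodule.inclusion hdom y := Subtype.ext (by
      rw [hw]; exact (mem_range_iff hPP).mp y.2)
    rw [hyw] at hTw
    exact (mem_range_iff hPP).mpr hTw.symm
  let A : W →ₗ[ℂ] W := LinearMap.codRestrict W (T.toFun ∘ₗ Submodule.inclusion hdom) hTW
  have hA : ∀ y : W, ((A y : W) : H) = T (Submodule.inclusion hdom y) := fun y => rfl
  have hAs : A.IsSymmetric := fun x y => by
    rw [Submodule.coe_inner, Submodule.coe_inner, hA, hA]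
    exact hT.pmap_inner_apply (Submodule.inclusion hdom x) (Submodule.inclusion hdom y)
  let b := hAs.eigenvectorBasis rfl
  have hb : ∀ i, (b i : H) ∈ ⨆ lam : Iio E, opEigenspace T lam := by
    intro i
    set l := hAs.eigenvalues rfl i with hl
    have hAb : A (b i) = (l : ℂ) • b i := hAs.apply_eigenvectorBasis rfl i
    have hTb : T (Submodule.inclusion hdom (b i)) = (l : ℂ) • (b i : H) := by
      rw [← hA, hAb]; rfl
    have hnorm : ‖(b i : H)‖ = 1 := b.orthonormal.1 i
    have hlE : l < E := by
      have h := hP.2.2.1 (Submodule.inclusion hdom (b i)) ((mem_range_iff hPP).mp (b i).2)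
        (by
          change (b i : H) ≠ 0
          rw [← norm_ne_zero_iff, hnorm]; exact one_ne_zero)
      rw [hTb] at h
      change (inner ℂ ((l : ℂ) • (b i : H)) (b i : H)).re < E * ‖(b i : H)‖ ^ 2 at h
      rw [inner_smul_left, inner_self_eq_norm_sq_to_K, hnorm] at h
      simpa using h
    exact Submodule.mem_iSup_of_mem (p := fun lam : Iio E => opEigenspace T lam) ⟨l, hlE⟩
      ⟨Submodule.inclusion hdom (b i), rfl, hTb⟩
  intro x hx
  have hsum := congrArg (fun y : W => (y : H)) (b.sum_repr ⟨x, hx⟩)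
  simp only [Submodule.coe_sum, Submodule.coe_smul] at hsum
  rw [← hsum]
  exact Submodule.sum_mem _ fun i _ => Submodule.smul_mem _ _ (hb i)

theorem rank_range_eq (hT : IsSelfAdjoint T) (hP : IsSpectralProjectorBelow T E P)
    (hdom : LinearMap.range (P : H →ₗ[ℂ] H) ≤ T.domain)
    [FiniteDimensional ℂ (LinearMap.range (P : H →ₗ[ℂ] H))] :
    Module.rank ℂ (LinearMap.range (P : H →ₗ[ℂ] H)) =
      Cardinal.sum fun lam : Iio E => Module.rank ℂ (opEigenspace T lam) := by
  have hind : iSupIndep fun lam : Iio E => opEigenspace T lam := iSupIndep_opEigenspace hT _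
  classical
  rw [← hP.iSup_opEigenspace hT hdom, Submodule.iSup_eq_range_dfinsupp_lsum,
    ← (LinearEquiv.ofInjective _ hind.dfinsupp_lsum_injective).rank_eq]
  exact rank_directSum (R := ℂ) fun lam : Iio E => opEigenspace T lam

/-- Vectors which diagonalize the form of `T` with values below `E` bound the dimension of the
spectral subspace from below. -/
theorem le_rank_range (hP : IsSpectralProjectorBelow T E P) {n : ℕ} (φ : Fin n → T.domain)
    (horth : ∀ i j, i ≠ j → inner ℂ (φ i : H) (φ j : H) = 0)
    (hTorth : ∀ i j, i ≠ j → inner ℂ (T (φ i)) (φ j : H) = 0)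
    (hlt : ∀ i, (inner ℂ (T (φ i)) (φ i : H)).re < E * ‖(φ i : H)‖ ^ 2) :
    (n : Cardinal) ≤ Module.rank ℂ (LinearMap.range (P : H →ₗ[ℂ] H)) := by
  have hli : LinearIndependent ℂ fun i => (⟨P (φ i : H), (φ i : H), rfl⟩ :
      LinearMap.range (P : H →ₗ[ℂ] H)) := by
    rw [Fintype.linearIndependent_iff]
    intro c hc
    have hc' := congrArg (fun y : LinearMap.range (P : H →ₗ[ℂ] H) => (y : H)) hc
    simp only [Submodule.coe_sum, Submodule.coe_smul, Submodule.coe_zero] at hc'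
    set u : T.domain := ∑ i, c i • φ i with hu
    have hucoe : (u : H) = ∑ i, c i • (φ i : H) := by simp [hu]
    have hTu : T u = ∑ i, c i • T (φ i) := by
      change T.toFun u = _
      rw [hu, map_sum]
      exact Finset.sum_congr rfl fun i _ => map_smul _ _ _
    have hPu : P u = 0 := by
      rw [hucoe, map_sum, ← hc']
      exact Finset.sum_congr rfl fun i _ => map_smul _ _ _
    have h := hP.2.2.2 u hPu
    have e1 : (inner ℂ (T u) (u : H)).re =
        ∑ i, ‖c i‖ ^ 2 * (inner ℂ (T (φ i)) (φ i : H)).re := by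
      rw [hTu, hucoe, sum_inner, Complex.re_sum]
      refine Finset.sum_congr rfl fun i _ => ?_
      rw [inner_sum, Finset.sum_eq_single i, inner_smul_left, inner_smul_right, ← mul_assoc,
        Complex.conj_mul', ← Complex.ofReal_pow, Complex.re_ofReal_mul]
      · intro j _ hj
        rw [inner_smul_left, inner_smul_right, hTorth i j hj.symm, mul_zero, mul_zero]
      · simp
    have e2 : ‖(u : H)‖ ^ 2 = ∑ i, ‖c i‖ ^ 2 * ‖(φ i : H)‖ ^ 2 := by
      have : ‖(u : H)‖ ^ 2 = (inner ℂ (u : H) (u : H)).re := by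
        rw [inner_self_eq_norm_sq_to_K]; simp [← Complex.ofReal_pow]
      rw [this, hucoe, sum_inner, Complex.re_sum]
      refine Finset.sum_congr rfl fun i _ => ?_
      rw [inner_sum, Finset.sum_eq_single i, inner_smul_left, inner_smul_right, ← mul_assoc,
        Complex.conj_mul', ← Complex.ofReal_pow, Complex.re_ofReal_mul, inner_self_eq_norm_sq_to_K]
      · simp [← Complex.ofReal_pow]
      · intro j _ hj
        rw [inner_smul_left, inner_smul_right, horth i j hj.symm, mul_zero, mul_zero]
      · simp
    rw [e1, e2, Finset.mul_sum, ← sub_nonpos, ← Finset.sum_sub_distrib] at h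
    intro i
    by_contra hi
    have hnn : ∀ j, 0 ≤ E * (‖c j‖ ^ 2 * ‖(φ j : H)‖ ^ 2) -
        ‖c j‖ ^ 2 * (inner ℂ (T (φ j)) (φ j : H)).re := fun j => by
      have := mul_nonneg (sq_nonneg ‖c j‖) (sub_nonneg.mpr (hlt j).le)
      linarith
    have hpos : 0 < E * (‖c i‖ ^ 2 * ‖(φ i : H)‖ ^ 2) -
        ‖c i‖ ^ 2 * (inner ℂ (T (φ i)) (φ i : H)).re := by
      have h1 : 0 < ‖c i‖ ^ 2 := by positivity
      have := mul_pos h1 (sub_pos.mpr (hlt i))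
      linarith
    have := Finset.sum_pos' (fun j _ => hnn j) ⟨i, Finset.mem_univ i, hpos⟩
    linarith
  simpa using hli.cardinal_lift_le_rank

end IsSpectralProjectorBelow

theorem IsSelfAdjoint.countingFunction_le_and_eq (hT : IsSelfAdjoint T) {E : ℝ} {M : ℕ}
    (hM : HasFormIndexLE T E M) :
    countingFunction T E ≤ M ∧ countingFunction T E = eigenvalueCount T E := by
  have key : ∀ P : H →L[ℂ] H, IsSpectralProjectorBelow T E P →
      Cardinal.toENat (Module.rank ℂ (LinearMap.range (P : H →ₗ[ℂ] H))) = eigenvalueCount T E ∧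
      Cardinal.toENat (Module.rank ℂ (LinearMap.range (P : H →ₗ[ℂ] H))) ≤ M := by
    intro P hP
    obtain ⟨hdom, hrank⟩ := hP.range_le_domain_and_rank_le hT hM
    have : FiniteDimensional ℂ (LinearMap.range (P : H →ₗ[ℂ] H)) :=
      Module.rank_lt_aleph0_iff.mp (hrank.trans_lt (Cardinal.natCast_lt_aleph0))
    refine ⟨?_, by simpa using hrank⟩
    rw [hP.rank_range_eq hT hdom, eigenvalueCount]
  obtain ⟨P, hP⟩ := hT.exists_isSpectralProjectorBelow hM
  refine ⟨iSup₂_le fun Q hQ => (key Q hQ).2, le_antisymm (iSup₂_le fun Q hQ => (key Q hQ).1.le) ?_⟩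
  rw [← (key P hP).1]
  exact le_iSup₂ (f := fun (P : H →L[ℂ] H) (_ : IsSpectralProjectorBelow T E P) =>
    Cardinal.toENat (Module.rank ℂ (LinearMap.range (P : H →ₗ[ℂ] H)))) P hP

theorem IsSelfAdjoint.le_countingFunction (hT : IsSelfAdjoint T) {E : ℝ} {M : ℕ}
    (hM : HasFormIndexLE T E M) {n : ℕ} (φ : Fin n → T.domain)
    (horth : ∀ i j, i ≠ j → inner ℂ (φ i : H) (φ j : H) = 0)
    (hTorth : ∀ i j, i ≠ j → inner ℂ (T (φ i)) (φ j : H) = 0)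
    (hlt : ∀ i, (inner ℂ (T (φ i)) (φ i : H)).re < E * ‖(φ i : H)‖ ^ 2) :
    n ≤ countingFunction T E := by
  obtain ⟨P, hP⟩ := hT.exists_isSpectralProjectorBelow hM
  have h := hP.le_rank_range φ horth hTorth hlt
  have h' : (n : ℕ∞) ≤ Cardinal.toENat (Module.rank ℂ (LinearMap.range (P : H →ₗ[ℂ] H))) := by
    simpa using h
  exact h'.trans (le_iSup₂ (f := fun (P : H →L[ℂ] H) (_ : IsSpectralProjectorBelow T E P) =>
    Cardinal.toENat (Module.rank ℂ (LinearMap.range (P : H →ₗ[ℂ] H)))) P hP)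

end Projector

/-! ### Form inequalities for real functions on a half-line -/

section HalfLine

/-- `F` is locally absolutely continuous on `[a, ∞)` with derivative `f` almost everywhere. -/
structure IsPrimitiveFrom {B : Type*} [NormedAddCommGroup B] [NormedSpace ℝ B] (a : ℝ)
    (F f : ℝ → B) : Prop where
  intervalIntegrable_from : ∀ b, a ≤ b → IntervalIntegrable f volume a b
  eq_add_integral : ∀ x, a ≤ x → F x = F a + ∫ t in a..x, f t

namespace IsPrimitiveFrom

section Vector

variable {B : Type*} [NormedAddCommGroup B] [NormedSpace ℝ B] {a α β : ℝ} {F f : ℝ → B}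

theorem intervalIntegrable (hF : IsPrimitiveFrom a F f) (hα : a ≤ α) (hβ : a ≤ β) :
    IntervalIntegrable f volume α β :=
  (hF.intervalIntegrable_from α hα).symm.trans (hF.intervalIntegrable_from β hβ)

theorem eq_add (hF : IsPrimitiveFrom a F f) (hα : a ≤ α) (hβ : a ≤ β) :
    F β = F α + ∫ t in α..β, f t := by
  have h := intervalIntegral.integral_add_adjacent_intervals (hF.intervalIntegrable_from α hα)
    (hF.intervalIntegrable hα hβ)
  rw [hF.eq_add_integral β hβ, hF.eq_add_integral α hα, ← h, add_assoc]

theorem continuousOn (hF : IsPrimitiveFrom a F f) : ContinuousOn F (Ici a) := by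
  have key : ∀ b, a ≤ b → ContinuousOn F (Icc a b) := fun b hb => by
    have h := intervalIntegral.continuousOn_primitive_interval
      ((intervalIntegrable_iff' (by finiteness)).mp (hF.intervalIntegrable_from b hb))
    rw [uIcc_of_le hb] at h
    exact (h.const_add (F a)).congr fun x hx => hF.eq_add_integral x hx.1
  intro x hx
  have hx' : a ≤ x := hx
  have h := key (x + 1) (by linarith) x ⟨hx, by linarith⟩
  refine h.mono_of_mem_nhdsWithin ?_
  rw [← Ici_inter_Iic]
  exact inter_mem self_mem_nhdsWithin (mem_nhdsWithin_of_mem_nhds (Iic_mem_nhds (by linarith)))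

theorem comp_clm [CompleteSpace B] (hF : IsPrimitiveFrom a F f) (L : B →L[ℝ] ℝ) :
    IsPrimitiveFrom a (fun x => L (F x)) fun x => L (f x) where
  intervalIntegrable_from b hb :=
    ⟨L.integrable_comp (hF.intervalIntegrable_from b hb).1,
      L.integrable_comp (hF.intervalIntegrable_from b hb).2⟩
  eq_add_integral x hx := by
    rw [L.intervalIntegral_comp_comm (hF.intervalIntegrable_from x hx), ← map_add,
      ← hF.eq_add_integral x hx]

end Vector

variable {a α β : ℝ} {F f G g : ℝ → ℝ}

theorem hasDerivAt (hF : IsPrimitiveFrom a F f) (hf : ContinuousOn f (Ici a)) {x : ℝ}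
    (hx : a < x) : HasDerivAt F (f x) x := by
  have h1 : HasDerivAt (fun y => F a + ∫ t in a..y, f t) (f x) x := by
    refine (intervalIntegral.integral_hasDerivAt_right (hF.intervalIntegrable_from x hx.le) ?_
      (hf.continuousAt (Ici_mem_nhds hx))).const_add _
    exact (hf.mono Ioi_subset_Ici_self).stronglyMeasurableAtFilter isOpen_Ioi x hx
  refine h1.congr_of_eventuallyEq ?_
  filter_upwards [Ioi_mem_nhds hx] with y hy
  exact hF.eq_add_integral y (le_of_lt hy)

/-- Integration by parts. -/
theorem integral_mul_add (hF : IsPrimitiveFrom a F f) (hG : IsPrimitiveFrom a G g)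
    (hα : a ≤ α) (hαβ : α ≤ β) :
    ∫ x in α..β, (f x * G x + F x * g x) = F β * G β - F α * G α := by
  have hβ := hα.trans hαβ
  have ac : ∀ {F f : ℝ → ℝ}, IsPrimitiveFrom a F f →
      AbsolutelyContinuousOnInterval (fun x => F α + ∫ t in α..x, f t) α β := fun {F f} hF =>
    ((LipschitzWith.const (F α)).lipschitzOnWith
      (s := uIcc α β)).absolutelyContinuousOnInterval.add
      ((hF.intervalIntegrable hα hβ).absolutelyContinuousOnInterval_intervalIntegral (by simp))
  have hd : ∀ {F f : ℝ → ℝ}, IsPrimitiveFrom a F f →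
      ∀ᵐ x, x ∈ uIcc α β → deriv (fun x => F α + ∫ t in α..x, f t) x = f x := fun {F f} hF => by
    filter_upwards [(hF.intervalIntegrable hα hβ).ae_hasDerivAt_integral] with x hx hx'
    exact ((hx hx' α (by simp)).const_add _).deriv
  have h := (ac hF).integral_deriv_mul_eq_sub (ac hG)
  simp only [intervalIntegral.integral_same, add_zero, ← hF.eq_add hα hβ, ← hG.eq_add hα hβ] at h
  rw [← h]
  refine intervalIntegral.integral_congr_ae ?_
  filter_upwards [hd hF, hd hG] with x h1 h2 hx
  have hx' := uIoc_subset_uIcc hx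
  rw [h1 hx', h2 hx']
  rw [uIcc_of_le hαβ] at hx'
  rw [← hF.eq_add hα (hα.trans hx'.1), ← hG.eq_add hα (hα.trans hx'.1)]

end IsPrimitiveFrom

/-- A sharp Hardy inequality between two zeros: Picone's identity with the positive solution
`√x * sin (κ * log (x / α) + θ)` of `y'' = -(κ² + 1/4) / x² * y`, whose logarithmic derivative
is `r`. -/
theorem hardy_between_zeros {a α β κ : ℝ} {g p : ℝ → ℝ} (hα : a ≤ α) (hα0 : 0 < α) (hαβ : α ≤ β)
    (hκ : 0 ≤ κ) (hκπ : κ * Real.log (β / α) < Real.pi) (hg : IsPrimitiveFrom a g p)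
    (hp : ContinuousOn p (Ici a)) (hgα : g α = 0) (hgβ : g β = 0) :
    (κ ^ 2 + 1 / 4) * ∫ x in α..β, g x ^ 2 / x ^ 2 ≤ ∫ x in α..β, p x ^ 2 := by
  set θ := (Real.pi - κ * Real.log (β / α)) / 2 with hθ
  have hθ0 : 0 < θ := by rw [hθ]; linarith
  set s : ℝ → ℝ := fun x => κ * Real.log (x / α) + θ with hs
  set r : ℝ → ℝ := fun x => (1 / 2 + κ * (Real.cos (s x) / Real.sin (s x))) / x with hr
  have hpos : ∀ x ∈ Icc α β, 0 < x := fun x hx => hα0.trans_le hx.1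
  have hsin : ∀ x ∈ Icc α β, 0 < Real.sin (s x) := by
    intro x hx
    have hx0 := hpos x hx
    have h1 : 0 ≤ Real.log (x / α) := Real.log_nonneg ((one_le_div hα0).mpr hx.1)
    have h2 : Real.log (x / α) ≤ Real.log (β / α) :=
      Real.log_le_log (by positivity) (by gcongr; exact hx.2)
    have h3 := mul_nonneg hκ h1
    have h4 := mul_le_mul_of_nonneg_left h2 hκ
    refine Real.sin_pos_of_pos_of_lt_pi ?_ ?_ <;> simp only [hs, hθ] <;> linarith
  have hs' : ∀ x ∈ Icc α β, HasDerivAt s (κ / x) x := by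
    intro x hx
    have hx0 := hpos x hx
    have h1 := ((((hasDerivAt_id x).div_const α).log (by simp; grind)).const_mul κ).add_const θ
    refine h1.congr_deriv ?_
    simp only [id]
    field_simp
  have hr' : ∀ x ∈ Icc α β, HasDerivAt r (-(κ ^ 2 + 1 / 4) / x ^ 2 - r x ^ 2) x := by
    intro x hx
    have hx0 := hpos x hx
    have hsn := hsin x hx
    have h1 := ((((hs' x hx).cos.div (hs' x hx).sin hsn.ne').const_mul κ).const_add (1 / 2)).div
      (hasDerivAt_id x) hx0.ne'
    refine h1.congr_deriv ?_
    simp only [hr, id, Pi.div_apply]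
    field_simp
    ring
  have hrc : ContinuousOn r (Icc α β) := fun x hx => (hr' x hx).continuousAt.continuousWithinAt
  have hsub : Icc α β ⊆ Ici a := fun x hx => hα.trans hx.1
  have hgc : ContinuousOn g (Icc α β) := hg.continuousOn.mono hsub
  have hpc : ContinuousOn p (Icc α β) := hp.mono hsub
  have hxc : ContinuousOn (fun x : ℝ => g x ^ 2 / x ^ 2) (Icc α β) :=
    (hgc.pow 2).div (continuousOn_id.pow 2) fun x hx => pow_ne_zero _ (hpos x hx).ne'
  have hint : ∀ {k : ℝ → ℝ}, ContinuousOn k (Icc α β) → IntervalIntegrable k volume α β :=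
    fun hk => ContinuousOn.intervalIntegrable (by rwa [uIcc_of_le hαβ])
  have hdc : ContinuousOn (fun x => (-(κ ^ 2 + 1 / 4) / x ^ 2 - r x ^ 2) * g x ^ 2 +
      r x * (2 * g x * p x)) (Icc α β) := by
    refine ContinuousOn.add (ContinuousOn.mul (ContinuousOn.sub (ContinuousOn.div
      continuousOn_const (continuousOn_id.pow 2) fun x hx => pow_ne_zero _ (hpos x hx).ne')
      (hrc.pow 2)) (hgc.pow 2)) (hrc.mul ((continuousOn_const.mul hgc).mul hpc))
  have hFTC : ∫ x in α..β, ((-(κ ^ 2 + 1 / 4) / x ^ 2 - r x ^ 2) * g x ^ 2 +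
      r x * (2 * g x * p x)) = r β * g β ^ 2 - r α * g α ^ 2 := by
    refine intervalIntegral.integral_eq_sub_of_hasDerivAt_of_le hαβ (hrc.mul (hgc.pow 2))
      (fun x hx => ?_) (hint hdc)
    have h1 := (hr' x (Ioo_subset_Icc_self hx)).mul ((hg.hasDerivAt hp (hα.trans_lt hx.1)).pow 2)
    refine h1.congr_deriv ?_
    simp
  have hsq : 0 ≤ ∫ x in α..β, (p x - r x * g x) ^ 2 :=
    intervalIntegral.integral_nonneg hαβ fun x _ => sq_nonneg _
  have hp2 : IntervalIntegrable (fun x => p x ^ 2) volume α β := hint (hpc.pow 2)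
  have hg2 : IntervalIntegrable (fun x => (κ ^ 2 + 1 / 4) * (g x ^ 2 / x ^ 2)) volume α β :=
    (hint hxc).const_mul _
  have hid : ∫ x in α..β, (p x - r x * g x) ^ 2 = (∫ x in α..β, p x ^ 2) -
      ((κ ^ 2 + 1 / 4) * ∫ x in α..β, g x ^ 2 / x ^ 2) -
      ∫ x in α..β, ((-(κ ^ 2 + 1 / 4) / x ^ 2 - r x ^ 2) * g x ^ 2 + r x * (2 * g x * p x)) := by
    rw [← intervalIntegral.integral_const_mul, ← intervalIntegral.integral_sub hp2 hg2,
      ← intervalIntegral.integral_sub (hp2.sub hg2) (hint hdc)]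
    refine intervalIntegral.integral_congr fun x hx => ?_
    rw [uIcc_of_le hαβ] at hx
    have := hpos x hx
    field_simp
    ring
  rw [hFTC, hgα, hgβ] at hid
  linarith [hid, hsq]

/-- Nonnegativity of the form of `-h² d²/dx² + q` between two consecutive Dirichlet points. -/
theorem form_nonneg_between_zeros {a α β κ h A : ℝ} {g p w q : ℝ → ℝ} (hα : a ≤ α) (hα0 : 0 < α)
    (hαβ : α ≤ β) (hκ : 0 ≤ κ) (hκπ : κ * Real.log (β / α) < Real.pi)
    (hA : A ≤ h ^ 2 * (κ ^ 2 + 1 / 4)) (hg : IsPrimitiveFrom a g p) (hp : IsPrimitiveFrom a p w)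
    (hq : IntervalIntegrable (fun x => q x * g x ^ 2) volume α β)
    (hqA : ∀ᵐ x, x ∈ Ioc α β → -(A / x ^ 2) ≤ q x) (hgα : g α = 0) (hgβ : g β = 0) :
    0 ≤ ∫ x in α..β, (-(h ^ 2 * (w x * g x)) + q x * g x ^ 2) := by
  have hβ := hα.trans hαβ
  have hsub : Icc α β ⊆ Ici a := fun x hx => hα.trans hx.1
  have hgc : ContinuousOn g (Icc α β) := hg.continuousOn.mono hsub
  have hpc : ContinuousOn p (Icc α β) := hp.continuousOn.mono hsub
  have hint : ∀ {k : ℝ → ℝ}, ContinuousOn k (Icc α β) → IntervalIntegrable k volume α β :=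
    fun hk => ContinuousOn.intervalIntegrable (by rwa [uIcc_of_le hαβ])
  have hwg : IntervalIntegrable (fun x => w x * g x) volume α β :=
    (hp.intervalIntegrable hα hβ).mul_continuousOn (by rwa [uIcc_of_le hαβ])
  have hibp := hp.integral_mul_add hg hα hαβ
  have hp2 : IntervalIntegrable (fun x => p x * p x) volume α β := hint (hpc.mul hpc)
  have hwg' : IntervalIntegrable (fun x => -(h ^ 2 * (w x * g x))) volume α β :=
    (hwg.const_mul _).neg
  rw [hgα, hgβ, intervalIntegral.integral_add hwg hp2] at hibp
  have hhardy := hardy_between_zeros hα hα0 hαβ hκ hκπ hg hp.continuousOn hgα hgβ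
  have hxc : ContinuousOn (fun x : ℝ => g x ^ 2 / x ^ 2) (Icc α β) :=
    (hgc.pow 2).div (continuousOn_id.pow 2) fun x hx => pow_ne_zero _ (hα0.trans_le hx.1).ne'
  have hlow : -(h ^ 2 * (κ ^ 2 + 1 / 4)) * ∫ x in α..β, g x ^ 2 / x ^ 2 ≤
      ∫ x in α..β, q x * g x ^ 2 := by
    rw [← intervalIntegral.integral_const_mul]
    refine intervalIntegral.integral_mono_ae_restrict hαβ ((hint hxc).const_mul _) hq ?_
    rw [EventuallyLE, ← restrict_Ioc_eq_restrict_Icc, ae_restrict_iff' measurableSet_Ioc]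
    filter_upwards [hqA] with x hx hxm
    have hx0 : 0 < x := hα0.trans hxm.1
    calc -(h ^ 2 * (κ ^ 2 + 1 / 4)) * (g x ^ 2 / x ^ 2) ≤ -A * (g x ^ 2 / x ^ 2) :=
          mul_le_mul_of_nonneg_right (neg_le_neg hA) (by positivity)
      _ = -(A / x ^ 2) * g x ^ 2 := by ring
      _ ≤ _ := mul_le_mul_of_nonneg_right (hx hxm) (sq_nonneg _)
  rw [intervalIntegral.integral_add hwg' hq, intervalIntegral.integral_neg,
    intervalIntegral.integral_const_mul]
  have hpp : ∫ x in α..β, p x ^ 2 = ∫ x in α..β, p x * p x := by simp only [sq]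
  have := mul_le_mul_of_nonneg_left hhardy (sq_nonneg h)
  nlinarith

/-- The points dividing `[α, β]` into `N` intervals of equal logarithmic length. -/
noncomputable def logGrid (α β : ℝ) (N i : ℕ) : ℝ := α * Real.exp (i * (Real.log (β / α) / N))

theorem logGrid_zero (α β : ℝ) (N : ℕ) : logGrid α β N 0 = α := by simp [logGrid]

theorem logGrid_self {α β : ℝ} {N : ℕ} (hα : 0 < α) (hβ : 0 < β) (hN : 0 < N) :
    logGrid α β N N = β := by
  have : (N : ℝ) ≠ 0 := by positivity
  rw [logGrid, mul_div_cancel₀ _ this, Real.exp_log (by positivity)]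
  field_simp

theorem logGrid_monotone {α β : ℝ} {N : ℕ} (hα : 0 < α) (hαβ : α ≤ β) :
    Monotone (logGrid α β N) := by
  intro i j hij
  have h1 : 0 ≤ Real.log (β / α) := Real.log_nonneg ((one_le_div hα).mpr hαβ)
  unfold logGrid
  gcongr

theorem form_nonneg_of_zero_on_logGrid {a α β κ h A : ℝ} {N : ℕ} {g p w q : ℝ → ℝ} (hα : a ≤ α)
    (hα0 : 0 < α) (hαβ : α ≤ β) (hN : 0 < N) (hκ : 0 ≤ κ)
    (hκπ : κ * Real.log (β / α) < N * Real.pi)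
    (hA : A ≤ h ^ 2 * (κ ^ 2 + 1 / 4)) (hg : IsPrimitiveFrom a g p) (hp : IsPrimitiveFrom a p w)
    (hq : IntervalIntegrable (fun x => q x * g x ^ 2) volume α β)
    (hqA : ∀ᵐ x, x ∈ Ioc α β → -(A / x ^ 2) ≤ q x)
    (hgz : ∀ i ≤ N, g (logGrid α β N i) = 0) :
    0 ≤ ∫ x in α..β, (-(h ^ 2 * (w x * g x)) + q x * g x ^ 2) := by
  have hβ0 : 0 < β := hα0.trans_le hαβ
  have hmono := logGrid_monotone (N := N) hα0 hαβ
  have hmem : ∀ i ≤ N, logGrid α β N i ∈ Icc α β := fun i hi =>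
    ⟨by conv_lhs => rw [← logGrid_zero α β N]
        exact hmono (Nat.zero_le i),
      by conv_rhs => rw [← logGrid_self hα0 hβ0 hN]
         exact hmono hi⟩
  have hwg : IntervalIntegrable (fun x => w x * g x) volume α β :=
    (hp.intervalIntegrable hα (hα.trans hαβ)).mul_continuousOn
      (by rw [uIcc_of_le hαβ]; exact hg.continuousOn.mono fun x hx => hα.trans hx.1)
  have hsub : ∀ i < N, uIcc (logGrid α β N i) (logGrid α β N (i + 1)) ⊆ uIcc α β := fun i hi => by
    rw [uIcc_of_le (hmono i.le_succ), uIcc_of_le hαβ]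
    exact Icc_subset_Icc (hmem i hi.le).1 (hmem (i + 1) hi).2
  have hsum := intervalIntegral.sum_integral_adjacent_intervals (n := N) (a := logGrid α β N)
    (f := fun x => -(h ^ 2 * (w x * g x)) + q x * g x ^ 2) (μ := volume)
    fun i hi => (((hwg.const_mul _).neg.add hq)).mono_set (hsub i hi)
  rw [logGrid_zero, logGrid_self hα0 hβ0 hN] at hsum
  rw [← hsum]
  refine Finset.sum_nonneg fun i hi => ?_
  have hi := Finset.mem_range.mp hi
  have hNpos : (0 : ℝ) < N := by exact_mod_cast hN
  have hi0 : 0 < logGrid α β N i := hα0.trans_le (hmem i hi.le).1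
  have hratio : Real.log (logGrid α β N (i + 1) / logGrid α β N i) = Real.log (β / α) / N := by
    rw [logGrid, logGrid, mul_div_mul_left _ _ hα0.ne', ← Real.exp_sub, Real.log_exp]
    push_cast
    ring
  refine form_nonneg_between_zeros (κ := κ) (A := A) (hα.trans (hmem i hi.le).1) hi0
    (hmono i.le_succ) hκ ?_ hA hg hp (hq.mono_set (hsub i hi)) ?_ (hgz i hi.le) (hgz (i + 1) hi)
  · rw [hratio, ← mul_div_assoc, div_lt_iff₀ hNpos, mul_comm Real.pi]
    exact hκπ
  · filter_upwards [hqA] with x hx hxm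
    exact hx ⟨(hmem i hi.le).1.trans_lt hxm.1, hxm.2.trans (hmem (i + 1) hi).2⟩

/-- If `g` is square integrable, then `g * g'` cannot stay away from zero from above: otherwise
`g²` would grow linearly. This replaces the decay of `g` and `g'` at infinity. -/
theorem exists_mul_deriv_le {a X₀ ε : ℝ} {g p : ℝ → ℝ} (hg : IsPrimitiveFrom a g p)
    (hp : ContinuousOn p (Ici a)) (hint : IntegrableOn (fun x => g x ^ 2) (Ioi a))
    (hX₀ : a ≤ X₀) (hε : 0 < ε) : ∃ X ≥ X₀, p X * g X ≤ ε := by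
  by_contra! hcon
  have hgrow : ∀ X ≥ X₀ + 1, 2 * ε ≤ g X ^ 2 := by
    intro X hX
    have hX' : X₀ ≤ X := by linarith
    have h1 := hg.integral_mul_add hg hX₀ hX'
    have hc : ContinuousOn (fun x => p x * g x + g x * p x) (uIcc X₀ X) := by
      rw [uIcc_of_le hX']
      have hs : Icc X₀ X ⊆ Ici a := fun x hx => hX₀.trans hx.1
      exact ((hp.mul hg.continuousOn).add (hg.continuousOn.mul hp)).mono hs
    have h2 : ∫ _ in X₀..X, 2 * ε ≤ ∫ x in X₀..X, (p x * g x + g x * p x) :=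
      intervalIntegral.integral_mono_on hX' intervalIntegrable_const hc.intervalIntegrable
        fun x hx => by nlinarith [hcon x hx.1]
    rw [intervalIntegral.integral_const, h1, smul_eq_mul] at h2
    nlinarith [mul_self_nonneg (g X₀)]
  have hconst : IntegrableOn (fun _ : ℝ => 2 * ε) (Ioi (X₀ + 1)) := by
    refine Integrable.mono' (hint.mono_set (Ioi_subset_Ioi (by linarith)))
      aestronglyMeasurable_const ?_
    filter_upwards [ae_restrict_mem measurableSet_Ioi] with x hx
    rw [Real.norm_of_nonneg (by positivity)]
    exact hgrow x (le_of_lt hx)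
  rw [integrableOn_const_iff] at hconst
  rcases hconst with h | h
  · simp at h; linarith
  · simp at h

/-- Dirichlet bracketing on the half-line. The form of `-h² d²/dx² + q` is nonnegative on a function
vanishing at `N₀ + N₁ + 2` suitable points, if `q ≥ -A₀ / x²` on `(a, R)`, `q ≥ -A₁ / x²` on
`(R, S)` and `q ≥ 0` beyond `S`. -/
theorem form_nonneg_halfLine {a R S κ₀ κ₁ h A₀ A₁ : ℝ} {N₀ N₁ : ℕ} {g p w q : ℝ → ℝ} (ha : 0 < a)
    (haR : a ≤ R) (hRS : R ≤ S) (hN₀ : 0 < N₀) (hN₁ : 0 < N₁) (hκ₀ : 0 ≤ κ₀) (hκ₁ : 0 ≤ κ₁)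
    (hκπ₀ : κ₀ * Real.log (R / a) < N₀ * Real.pi) (hκπ₁ : κ₁ * Real.log (S / R) < N₁ * Real.pi)
    (hA₀ : A₀ ≤ h ^ 2 * (κ₀ ^ 2 + 1 / 4)) (hA₁ : A₁ ≤ h ^ 2 * (κ₁ ^ 2 + 1 / 4))
    (hg : IsPrimitiveFrom a g p) (hp : IsPrimitiveFrom a p w)
    (hgint : IntegrableOn (fun x => g x ^ 2) (Ioi a))
    (hint : IntegrableOn (fun x => -(h ^ 2 * (w x * g x)) + q x * g x ^ 2) (Ioi a))
    (hq₀ : ∀ᵐ x, x ∈ Ioc a R → -(A₀ / x ^ 2) ≤ q x)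
    (hq₁ : ∀ᵐ x, x ∈ Ioc R S → -(A₁ / x ^ 2) ≤ q x)
    (hq₂ : ∀ᵐ x, x ∈ Ioi S → 0 ≤ q x)
    (hz₀ : ∀ i ≤ N₀, g (logGrid a R N₀ i) = 0) (hz₁ : ∀ i ≤ N₁, g (logGrid R S N₁ i) = 0) :
    0 ≤ ∫ x in Ioi a, (-(h ^ 2 * (w x * g x)) + q x * g x ^ 2) := by
  have haS := haR.trans hRS
  have hR0 := ha.trans_le haR
  have hS0 := hR0.trans_le hRS
  set j : ℝ → ℝ := fun x => -(h ^ 2 * (w x * g x)) + q x * g x ^ 2 with hj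
  have hji : ∀ {c d : ℝ}, a ≤ c → c ≤ d → IntervalIntegrable j volume c d := fun hc hcd =>
    (intervalIntegrable_iff_integrableOn_Ioc_of_le hcd).mpr
      (hint.mono_set fun x hx => hc.trans_lt hx.1)
  have hwg : ∀ {c d : ℝ}, a ≤ c → c ≤ d → IntervalIntegrable (fun x => w x * g x) volume c d :=
    fun {c d} hc hcd => (hp.intervalIntegrable hc (hc.trans hcd)).mul_continuousOn
      (by rw [uIcc_of_le hcd]; exact hg.continuousOn.mono fun x hx => hc.trans hx.1)
  have hqg : ∀ {c d : ℝ}, a ≤ c → c ≤ d →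
      IntervalIntegrable (fun x => q x * g x ^ 2) volume c d := fun hc hcd => by
    refine ((hji hc hcd).add ((hwg hc hcd).const_mul (h ^ 2))).congr fun x _ => ?_
    simp only [hj]; ring
  have h0 : 0 ≤ ∫ x in a..R, j x := form_nonneg_of_zero_on_logGrid le_rfl ha haR hN₀ hκ₀ hκπ₀ hA₀
    hg hp (hqg le_rfl haR) hq₀ hz₀
  have h1 : 0 ≤ ∫ x in R..S, j x := form_nonneg_of_zero_on_logGrid haR hR0 hRS hN₁ hκ₁ hκπ₁ hA₁
    hg hp (hqg haR hRS) hq₁ hz₁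
  have hgS : g S = 0 := by
    have := hz₁ N₁ le_rfl
    rwa [logGrid_self hR0 hS0 hN₁] at this
  have h2 : ∀ X, S ≤ X → -(h ^ 2 * (p X * g X)) ≤ ∫ x in S..X, j x := by
    intro X hSX
    have hs : uIcc S X ⊆ Ici a := by
      rw [uIcc_of_le hSX]; exact fun x hx => haS.trans hx.1
    have hpc : ContinuousOn (fun x => p x * p x) (uIcc S X) :=
      (hp.continuousOn.mul hp.continuousOn).mono hs
    have hibp := hp.integral_mul_add hg haS hSX
    rw [intervalIntegral.integral_add (hwg haS hSX) hpc.intervalIntegrable, hgS] at hibp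
    have hpp : 0 ≤ ∫ x in S..X, p x * p x :=
      intervalIntegral.integral_nonneg hSX fun x _ => mul_self_nonneg _
    have hqq : 0 ≤ ∫ x in S..X, q x * g x ^ 2 := by
      refine intervalIntegral.integral_nonneg_of_ae_restrict hSX ?_
      rw [EventuallyLE, ← restrict_Ioc_eq_restrict_Icc, ae_restrict_iff' measurableSet_Ioc]
      filter_upwards [hq₂] with x hx hxm
      exact mul_nonneg (hx hxm.1) (sq_nonneg _)
    have hwg' : IntervalIntegrable (fun x => -(h ^ 2 * (w x * g x))) volume S X :=
      ((hwg haS hSX).const_mul _).neg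
    simp only [hj]
    rw [intervalIntegral.integral_add hwg' (hqg haS hSX),
      intervalIntegral.integral_neg, intervalIntegral.integral_const_mul]
    nlinarith [mul_nonneg (sq_nonneg h) hpp]
  have h3 : ∀ X, S ≤ X → -(h ^ 2 * (p X * g X)) ≤ ∫ x in a..X, j x := by
    intro X hSX
    rw [← intervalIntegral.integral_add_adjacent_intervals (hji le_rfl haS) (hji haS hSX),
      ← intervalIntegral.integral_add_adjacent_intervals (hji le_rfl haR) (hji haR hRS)]
    linarith [h2 X hSX]
  have hseq : ∀ n : ℕ, ∃ X ≥ S + n, p X * g X ≤ 1 / ((n : ℝ) + 1) := fun n =>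
    exists_mul_deriv_le hg hp.continuousOn hgint (haS.trans (by linarith [n.cast_nonneg (α := ℝ)]))
      (by positivity)
  choose X hX hX' using hseq
  have hXtop : Tendsto X atTop atTop :=
    tendsto_atTop_mono hX (tendsto_atTop_add_const_left _ _ tendsto_natCast_atTop_atTop)
  have hlim := intervalIntegral_tendsto_integral_Ioi a hint hXtop
  have hlim0 : Tendsto (fun n : ℕ => -(h ^ 2 * (1 / ((n : ℝ) + 1)))) atTop (𝓝 0) := by
    have := (tendsto_one_div_add_atTop_nhds_zero_nat (𝕜 := ℝ)).const_mul (h ^ 2)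
    simpa using this.neg
  refine le_of_tendsto_of_tendsto' hlim0 hlim fun n => ?_
  refine le_trans ?_ (h3 (X n) (by linarith [hX n, n.cast_nonneg (α := ℝ)]))
  exact neg_le_neg (mul_le_mul_of_nonneg_left (hX' n) (sq_nonneg h))

end HalfLine

/-! ### The upper bound for Schrödinger realizations -/

section Realization

variable {a h : ℝ} {V : ℝ → ℝ} {T : HalfLineL2 a →ₗ.[ℂ] HalfLineL2 a}

/-- A square integrable function is locally integrable on `[a, ∞)`. -/
theorem HalfLineL2.intervalIntegrable (w : HalfLineL2 a) {b : ℝ} (hb : a ≤ b) :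
    IntervalIntegrable w volume a b := by
  rw [intervalIntegrable_iff_integrableOn_Ioc_of_le hb]
  have h1 : MemLp w 2 (volume.restrict (Ioc a b)) :=
    (Lp.memLp w).mono_measure (Measure.restrict_mono Ioc_subset_Ioi_self le_rfl)
  exact h1.integrable one_le_two

/-- The continuously differentiable representative `g` of an element `u` of the domain, with its
first derivative `p` and its second derivative `w`. -/
structure IsDomainRep (a h : ℝ) (V : ℝ → ℝ) (T : HalfLineL2 a →ₗ.[ℂ] HalfLineL2 a)
    (u : T.domain) (g p w : ℝ → ℂ) : Prop where
  ae_eq : (u : HalfLineL2 a) =ᵐ[volume.restrict (Ioi a)] g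
  prim_fst : IsPrimitiveFrom a g p
  prim_snd : IsPrimitiveFrom a p w
  apply_ae_eq : T u =ᵐ[volume.restrict (Ioi a)] fun x => -((h : ℂ) ^ 2) * w x + (V x : ℂ) * g x

theorem IsSchrodingerRealization.exists_rep (hT : IsSchrodingerRealization a h V T)
    (u : T.domain) : ∃ g p w, IsDomainRep a h V T u g p w := by
  obtain ⟨w, ⟨g, p, hu, hg, hp⟩, hTu⟩ := hT.2 u
  have hp' : IsPrimitiveFrom a p w := ⟨fun b hb => w.intervalIntegrable hb, hp⟩
  refine ⟨g, p, w, hu, ⟨fun b hb => ?_, hg⟩, hp', ?_⟩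
  · exact ContinuousOn.intervalIntegrable (hp'.continuousOn.mono
      (by rw [uIcc_of_le hb]; exact fun x hx => hx.1))
  · filter_upwards [hTu, hu] with x h1 h2
    rw [h1, h2]

theorem IsPrimitiveFrom.eqOn_of_ae_eq {F f G g : ℝ → ℂ} (hF : IsPrimitiveFrom a F f)
    (hG : IsPrimitiveFrom a G g) (h : F =ᵐ[volume.restrict (Ioi a)] G) : EqOn F G (Ici a) := by
  refine Measure.eqOn_of_ae_eq (μ := volume) ?_ hF.continuousOn hG.continuousOn ?_
  · rwa [← restrict_Ioi_eq_restrict_Ici]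
  · rw [interior_Ici, closure_Ioi]

/-- Point evaluation of the continuous representative is linear on the domain. -/
theorem IsSchrodingerRealization.exists_eval (hT : IsSchrodingerRealization a h V T) {M : ℕ}
    (z : Fin M → ℝ) (hz : ∀ k, a ≤ z k) :
    ∃ l : T.domain →ₗ[ℂ] (Fin M → ℂ), ∀ u, ∃ g p w, IsDomainRep a h V T u g p w ∧
      ∀ k, l u k = g (z k) := by
  choose G P W hrep using hT.exists_rep
  refine ⟨{ toFun := fun u k => G u (z k), map_add' := fun u v => ?_, map_smul' := fun c u => ?_ },
    fun u => ⟨G u, P u, W u, hrep u, fun k => rfl⟩⟩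
  · have hsum : IsPrimitiveFrom a (fun x => G u x + G v x) fun x => P u x + P v x := by
      refine ⟨fun b hb => ((hrep u).prim_fst.1 b hb).add ((hrep v).prim_fst.1 b hb),
        fun x hx => ?_⟩
      rw [intervalIntegral.integral_add ((hrep u).prim_fst.1 x hx) ((hrep v).prim_fst.1 x hx),
        (hrep u).prim_fst.2 x hx, (hrep v).prim_fst.2 x hx]
      ring
    ext k
    refine (hrep (u + v)).prim_fst.eqOn_of_ae_eq hsum ?_ (hz k)
    filter_upwards [(hrep (u + v)).ae_eq, (hrep u).ae_eq, (hrep v).ae_eq,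
      Lp.coeFn_add (u : HalfLineL2 a) v] with x h1 h2 h3 h4
    rw [← h1, Submodule.coe_add, h4, Pi.add_apply, h2, h3]
  · have hsmul : IsPrimitiveFrom a (fun x => c * G u x) fun x => c * P u x := by
      refine ⟨fun b hb => ((hrep u).prim_fst.1 b hb).const_mul c, fun x hx => ?_⟩
      rw [intervalIntegral.integral_const_mul, (hrep u).prim_fst.2 x hx]
      ring
    ext k
    refine (hrep (c • u)).prim_fst.eqOn_of_ae_eq hsmul ?_ (hz k)
    filter_upwards [(hrep (c • u)).ae_eq, (hrep u).ae_eq,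
      Lp.coeFn_smul c (u : HalfLineL2 a)] with x h1 h2 h3
    rw [← h1, Submodule.coe_smul, h3, Pi.smul_apply, h2, smul_eq_mul]

theorem HalfLineL2.re_inner_eq (u v : HalfLineL2 a) :
    (inner ℂ u v).re = (∫ x in Ioi a, (u x).re * (v x).re) + ∫ x in Ioi a, (u x).im * (v x).im := by
  have hre : ∀ f : HalfLineL2 a, MemLp (fun x => (f x).re) 2 (volume.restrict (Ioi a)) :=
    fun f => (Lp.memLp f).re
  have him : ∀ f : HalfLineL2 a, MemLp (fun x => (f x).im) 2 (volume.restrict (Ioi a)) :=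
    fun f => (Lp.memLp f).im
  have hrr : Integrable (fun x => (u x).re * (v x).re) (volume.restrict (Ioi a)) :=
    (hre u).integrable_mul (hre v)
  have hii : Integrable (fun x => (u x).im * (v x).im) (volume.restrict (Ioi a)) :=
    (him u).integrable_mul (him v)
  rw [← integral_add hrr hii,
    L2.inner_def, ← RCLike.re_eq_complex_re, ← integral_re (L2.integrable_inner u v)]
  refine integral_congr_ae (Eventually.of_forall fun x => ?_)
  simp only [RCLike.inner_apply, RCLike.re_eq_complex_re, Complex.mul_re, Complex.conj_re,
    Complex.conj_im]
  ring

/-- The contribution of the real or the imaginary part of `u` to the form of `T - E` is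
nonnegative when `u` vanishes on the grids. -/
theorem IsDomainRep.component_nonneg {u : T.domain} {g p w : ℝ → ℂ}
    (hrep : IsDomainRep a h V T u g p w) (L : ℂ →L[ℝ] ℝ)
    (hL : ∀ (r : ℝ) (z : ℂ), L (r * z) = r * L z)
    (hL2 : ∀ f : HalfLineL2 a, MemLp (fun x => L (f x)) 2 (volume.restrict (Ioi a)))
    {R S κ₀ κ₁ A₀ A₁ E : ℝ} {N₀ N₁ : ℕ} (ha : 0 < a)
    (haR : a ≤ R) (hRS : R ≤ S) (hN₀ : 0 < N₀) (hN₁ : 0 < N₁) (hκ₀ : 0 ≤ κ₀) (hκ₁ : 0 ≤ κ₁)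
    (hκπ₀ : κ₀ * Real.log (R / a) < N₀ * Real.pi) (hκπ₁ : κ₁ * Real.log (S / R) < N₁ * Real.pi)
    (hA₀ : A₀ ≤ h ^ 2 * (κ₀ ^ 2 + 1 / 4)) (hA₁ : A₁ ≤ h ^ 2 * (κ₁ ^ 2 + 1 / 4))
    (hq₀ : ∀ᵐ x, x ∈ Ioc a R → -(A₀ / x ^ 2) ≤ V x - E)
    (hq₁ : ∀ᵐ x, x ∈ Ioc R S → -(A₁ / x ^ 2) ≤ V x - E)
    (hq₂ : ∀ᵐ x, x ∈ Ioi S → 0 ≤ V x - E)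
    (hz₀ : ∀ i ≤ N₀, g (logGrid a R N₀ i) = 0) (hz₁ : ∀ i ≤ N₁, g (logGrid R S N₁ i) = 0) :
    E * ∫ x in Ioi a, L ((u : HalfLineL2 a) x) * L ((u : HalfLineL2 a) x) ≤
      ∫ x in Ioi a, L (T u x) * L ((u : HalfLineL2 a) x) := by
  have huu : Integrable (fun x => L ((u : HalfLineL2 a) x) * L ((u : HalfLineL2 a) x))
      (volume.restrict (Ioi a)) := (hL2 u).integrable_mul (hL2 u)
  have hTu : Integrable (fun x => L (T u x) * L ((u : HalfLineL2 a) x))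
      (volume.restrict (Ioi a)) := (hL2 (T u)).integrable_mul (hL2 u)
  have hj : (fun x => L (T u x) * L ((u : HalfLineL2 a) x) -
      E * (L ((u : HalfLineL2 a) x) * L ((u : HalfLineL2 a) x))) =ᵐ[volume.restrict (Ioi a)]
      fun x => -(h ^ 2 * (L (w x) * L (g x))) + (V x - E) * L (g x) ^ 2 := by
    filter_upwards [hrep.ae_eq, hrep.apply_ae_eq] with x h1 h2
    have h3 : L (T u x) = -h ^ 2 * L (w x) + V x * L (g x) := by
      rw [h2, map_add, show -(h : ℂ) ^ 2 = ((-h ^ 2 : ℝ) : ℂ) by push_cast; rfl, hL, hL]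
    rw [h3, h1]
    ring
  have hgint : IntegrableOn (fun x => L (g x) ^ 2) (Ioi a) := by
    refine huu.congr ?_
    filter_upwards [hrep.ae_eq] with x h1
    rw [h1, sq]
  have hnn := form_nonneg_halfLine (h := h) (q := fun x => V x - E) ha haR hRS hN₀ hN₁ hκ₀ hκ₁
    hκπ₀ hκπ₁ hA₀ hA₁ (hrep.prim_fst.comp_clm L) (hrep.prim_snd.comp_clm L) hgint
    ((hTu.sub (huu.const_mul E)).congr hj) hq₀ hq₁ hq₂
    (fun i hi => by rw [hz₀ i hi, map_zero]) (fun i hi => by rw [hz₁ i hi, map_zero])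
  rw [← integral_congr_ae hj, integral_sub hTu (huu.const_mul E), integral_const_mul] at hnn
  linarith

/-- The upper bound for the number of eigenvalues: Dirichlet conditions at the points of two
logarithmic grids make the form of `T - E` nonnegative. -/
theorem IsSchrodingerRealization.hasFormIndexLE (hT : IsSchrodingerRealization a h V T)
    {R S κ₀ κ₁ A₀ A₁ E : ℝ} {N₀ N₁ : ℕ} (ha : 0 < a)
    (haR : a ≤ R) (hRS : R ≤ S) (hN₀ : 0 < N₀) (hN₁ : 0 < N₁) (hκ₀ : 0 ≤ κ₀) (hκ₁ : 0 ≤ κ₁)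
    (hκπ₀ : κ₀ * Real.log (R / a) < N₀ * Real.pi) (hκπ₁ : κ₁ * Real.log (S / R) < N₁ * Real.pi)
    (hA₀ : A₀ ≤ h ^ 2 * (κ₀ ^ 2 + 1 / 4)) (hA₁ : A₁ ≤ h ^ 2 * (κ₁ ^ 2 + 1 / 4))
    (hq₀ : ∀ᵐ x, x ∈ Ioc a R → -(A₀ / x ^ 2) ≤ V x - E)
    (hq₁ : ∀ᵐ x, x ∈ Ioc R S → -(A₁ / x ^ 2) ≤ V x - E)
    (hq₂ : ∀ᵐ x, x ∈ Ioi S → 0 ≤ V x - E) :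
    HasFormIndexLE T E (N₀ + 1 + (N₁ + 1)) := by
  have hge : ∀ {α β : ℝ} {N : ℕ} (i : ℕ), a ≤ α → α ≤ β → a ≤ logGrid α β N i :=
    fun {α β N} i hα hαβ => by
      have := logGrid_monotone (N := N) (ha.trans_le hα) hαβ (Nat.zero_le i)
      rw [logGrid_zero] at this
      exact hα.trans this
  obtain ⟨l, hl⟩ := hT.exists_eval
    (Fin.append (fun i : Fin (N₀ + 1) => logGrid a R N₀ i)
      fun i : Fin (N₁ + 1) => logGrid R S N₁ i)
    (fun k => by
      refine Fin.addCases (fun i => ?_) (fun i => ?_) k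
      · rw [Fin.append_left]; exact hge _ le_rfl haR
      · rw [Fin.append_right]; exact hge _ haR hRS)
  refine ⟨l, fun u hu => ?_⟩
  obtain ⟨g, p, w, hrep, hk⟩ := hl u
  have hz₀ : ∀ i ≤ N₀, g (logGrid a R N₀ i) = 0 := fun i hi => by
    have := hk (Fin.castAdd (N₁ + 1) ⟨i, Nat.lt_succ_of_le hi⟩)
    rw [Fin.append_left, hu] at this
    exact this.symm
  have hz₁ : ∀ i ≤ N₁, g (logGrid R S N₁ i) = 0 := fun i hi => by
    have := hk (Fin.natAdd (N₀ + 1) ⟨i, Nat.lt_succ_of_le hi⟩)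
    rw [Fin.append_right, hu] at this
    exact this.symm
  have h1 := hrep.component_nonneg Complex.reCLM (fun r z => by simp)
    (fun f => (Lp.memLp f).re) ha haR hRS hN₀ hN₁ hκ₀ hκ₁ hκπ₀ hκπ₁ hA₀ hA₁ hq₀ hq₁ hq₂ hz₀ hz₁
  have h2 := hrep.component_nonneg Complex.imCLM (fun r z => by simp)
    (fun f => (Lp.memLp f).im) ha haR hRS hN₀ hN₁ hκ₀ hκ₁ hκπ₀ hκπ₁ hA₀ hA₁ hq₀ hq₁ hq₂ hz₀ hz₁
  have hnorm : ‖(u : HalfLineL2 a)‖ ^ 2 = (inner ℂ (u : HalfLineL2 a) (u : HalfLineL2 a)).re := by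
    rw [inner_self_eq_norm_sq_to_K]; simp [← Complex.ofReal_pow]
  rw [hnorm, HalfLineL2.re_inner_eq, HalfLineL2.re_inner_eq, mul_add]
  exact add_le_add h1 h2

end Realization

/-! ### Trial functions and the lower bound -/

section Trial

theorem IsPrimitiveFrom.mono {B : Type*} [NormedAddCommGroup B] [NormedSpace ℝ B] {a c : ℝ}
    {F f : ℝ → B} (hF : IsPrimitiveFrom a F f) (hac : a ≤ c) : IsPrimitiveFrom c F f :=
  ⟨fun _ hb => hF.intervalIntegrable hac (hac.trans hb),
    fun _ hx => hF.eq_add hac (hac.trans hx)⟩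

theorem IsPrimitiveFrom.of_hasDerivAt {c : ℝ} {F f : ℝ → ℝ}
    (hF : ∀ x, c ≤ x → HasDerivAt F (f x) x) (hf : ContinuousOn f (Ici c)) :
    IsPrimitiveFrom c F f := by
  have hint : ∀ b, c ≤ b → IntervalIntegrable f volume c b := fun b hb =>
    (hf.mono (by rw [uIcc_of_le hb]; exact fun x hx => hx.1)).intervalIntegrable
  refine ⟨hint, fun x hx => ?_⟩
  rw [intervalIntegral.integral_eq_sub_of_hasDerivAt (fun y hy => ?_) (hint x hx)]
  · ring
  · rw [uIcc_of_le hx] at hy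
    exact hF y hy.1

/-- Two integrations by parts against a real function with vanishing Cauchy data. -/
theorem IsPrimitiveFrom.integral_mul_eq {c d : ℝ} {F F₁ F₂ g p w : ℝ → ℝ} (hcd : c ≤ d)
    (hF : IsPrimitiveFrom c F F₁) (hF₁ : IsPrimitiveFrom c F₁ F₂) (hg : IsPrimitiveFrom c g p)
    (hp : IsPrimitiveFrom c p w) (hc : F c = 0) (hd : F d = 0) (hc₁ : F₁ c = 0) (hd₁ : F₁ d = 0) :
    ∫ x in c..d, F₂ x * g x = ∫ x in c..d, F x * w x := by
  have hco : ∀ {G k : ℝ → ℝ}, IsPrimitiveFrom c G k → ContinuousOn G (uIcc c d) := fun hG =>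
    hG.continuousOn.mono (by rw [uIcc_of_le hcd]; exact fun x hx => hx.1)
  have h1 := hF₁.integral_mul_add hg le_rfl hcd
  have h2 := hF.integral_mul_add hp le_rfl hcd
  have hFp : IntervalIntegrable (fun x => F₁ x * p x) volume c d :=
    ((hco hF₁).mul (hco hp)).intervalIntegrable
  rw [intervalIntegral.integral_add
    ((hF₁.intervalIntegrable_from d hcd).mul_continuousOn (hco hg)) hFp, hc₁, hd₁] at h1
  rw [intervalIntegral.integral_add hFp
    ((hp.intervalIntegrable_from d hcd).continuousOn_mul (hco hF)), hc, hd] at h2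
  linarith

theorem IsPrimitiveFrom.integral_ofReal_mul_eq {c d : ℝ} {F F₁ F₂ : ℝ → ℝ} {g p w : ℝ → ℂ}
    (hcd : c ≤ d) (hF : IsPrimitiveFrom c F F₁) (hF₁ : IsPrimitiveFrom c F₁ F₂)
    (hF₂ : ContinuousOn F₂ (Ici c)) (hg : IsPrimitiveFrom c g p) (hp : IsPrimitiveFrom c p w)
    (hc : F c = 0) (hd : F d = 0) (hc₁ : F₁ c = 0) (hd₁ : F₁ d = 0) :
    ∫ x in c..d, (F₂ x : ℂ) * g x = ∫ x in c..d, (F x : ℂ) * w x := by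
  have hsub : uIcc c d ⊆ Ici c := by rw [uIcc_of_le hcd]; exact fun x hx => hx.1
  have hi₂ : IntervalIntegrable (fun x => (F₂ x : ℂ) * g x) volume c d :=
    (((Complex.continuous_ofReal.comp_continuousOn hF₂).mul hg.continuousOn).mono
      hsub).intervalIntegrable
  have hi₀ : IntervalIntegrable (fun x => (F x : ℂ) * w x) volume c d :=
    (hp.intervalIntegrable_from d hcd).continuousOn_mul
      ((Complex.continuous_ofReal.comp_continuousOn hF.continuousOn).mono hsub)
  have key : ∀ L : ℂ →L[ℝ] ℝ, (∀ (r : ℝ) (z : ℂ), L (r * z) = r * L z) →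
      L (∫ x in c..d, (F₂ x : ℂ) * g x) = L (∫ x in c..d, (F x : ℂ) * w x) := fun L hL => by
    rw [← L.intervalIntegral_comp_comm hi₂, ← L.intervalIntegral_comp_comm hi₀]
    simp only [hL]
    exact IsPrimitiveFrom.integral_mul_eq hcd hF hF₁ (hg.comp_clm L) (hp.comp_clm L) hc hd hc₁ hd₁
  exact Complex.ext (key Complex.reCLM fun r z => by simp) (key Complex.imCLM fun r z => by simp)

theorem setIntegral_indicator_Ioc {B : Type*} [NormedAddCommGroup B] [NormedSpace ℝ B] {a c d : ℝ}
    (hac : a ≤ c) (hcd : c ≤ d) (f : ℝ → B) :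
    ∫ x in Ioi a, (Ioc c d).indicator f x = ∫ x in c..d, f x := by
  rw [setIntegral_indicator measurableSet_Ioc, intervalIntegral.integral_of_le hcd,
    inter_eq_right.mpr (show Ioc c d ⊆ Ioi a from fun x hx => lt_of_le_of_lt hac hx.1)]

variable {a h : ℝ} {V : ℝ → ℝ} {T : HalfLineL2 a →ₗ.[ℂ] HalfLineL2 a}

/-- A compactly supported `H²` function on `(a, ∞)` lies in the domain of every self-adjoint
realization, since by partial integration it lies in the domain of the adjoint. -/
theorem IsSchrodingerRealization.exists_trial (hT : IsSchrodingerRealization a h V T)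
    (hV : MemLp V ⊤ (volume.restrict (Ioi a))) {c d : ℝ} (hac : a ≤ c) (hcd : c ≤ d)
    {F F₁ F₂ : ℝ → ℝ} (hF : IsPrimitiveFrom c F F₁) (hF₁ : IsPrimitiveFrom c F₁ F₂)
    (hF₂ : ContinuousOn F₂ (Ici c)) (hc : F c = 0) (hd : F d = 0) (hc₁ : F₁ c = 0)
    (hd₁ : F₁ d = 0) :
    ∃ φ : T.domain,
      ((φ : HalfLineL2 a) =ᵐ[volume.restrict (Ioi a)]
        (Ioc c d).indicator fun x => ((F x : ℝ) : ℂ)) ∧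
      (T φ =ᵐ[volume.restrict (Ioi a)]
        (Ioc c d).indicator fun x => ((-h ^ 2 * F₂ x + V x * F x : ℝ) : ℂ)) := by
  have hsub : Ioc c d ⊆ Ioi a := fun x hx => lt_of_le_of_lt hac hx.1
  have hmem : ∀ {k : ℝ → ℝ}, MemLp k ⊤ (volume.restrict (Ioc c d)) →
      MemLp ((Ioc c d).indicator fun x => ((k x : ℝ) : ℂ)) 2 (volume.restrict (Ioi a)) := by
    intro k hk
    rw [memLp_indicator_iff_restrict measurableSet_Ioc, Measure.restrict_restrict_of_subset hsub]
    exact (hk.mono_exponent le_top).ofReal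
  have hcont : ∀ {k : ℝ → ℝ}, ContinuousOn k (Ici c) → MemLp k ⊤ (volume.restrict (Ioc c d)) := by
    intro k hk
    have hk' : ContinuousOn k (Icc c d) := hk.mono fun x hx => hx.1
    obtain ⟨K, hK⟩ := isCompact_Icc.exists_bound_of_continuousOn hk'
    refine memLp_top_of_bound
      ((hk'.mono Ioc_subset_Icc_self).aestronglyMeasurable measurableSet_Ioc) K ?_
    filter_upwards [ae_restrict_mem measurableSet_Ioc] with x hx
    exact hK x (Ioc_subset_Icc_self hx)
  have hφ := hmem (hcont hF.continuousOn)
  have hVF : MemLp (fun x => -h ^ 2 * F₂ x + V x * F x) ⊤ (volume.restrict (Ioc c d)) :=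
    ((hcont hF₂).const_mul _).add
      (MemLp.mul (hcont hF.continuousOn) (hV.mono_measure (Measure.restrict_mono hsub le_rfl)))
  have hψ := hmem hVF
  obtain ⟨φ, hφ1, hφ2⟩ := hT.1.pmap_exists_eq (φ := hφ.toLp _) (ψ := hψ.toLp _) fun u => by
    obtain ⟨g, p, w, hrep⟩ := hT.exists_rep u
    have hg := hrep.prim_fst.mono hac
    have hp := hrep.prim_snd.mono hac
    have hsubI : uIcc c d ⊆ Ici c := by rw [uIcc_of_le hcd]; exact fun x hx => hx.1
    have hgc := hg.continuousOn.mono hsubI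
    have hFc : ContinuousOn (fun x => (F x : ℂ)) (uIcc c d) :=
      (Complex.continuous_ofReal.comp_continuousOn hF.continuousOn).mono hsubI
    have hVi : IntervalIntegrable (fun x => (V x : ℂ)) volume c d := by
      rw [intervalIntegrable_iff_integrableOn_Ioc_of_le hcd]
      exact ((hV.mono_measure (Measure.restrict_mono hsub le_rfl)).mono_exponent
        le_top).ofReal.integrable le_rfl
    have hVFg : IntervalIntegrable (fun x => (V x : ℂ) * ((F x : ℂ) * g x)) volume c d :=
      hVi.mul_continuousOn (hFc.mul hgc)
    have hF₂g : IntervalIntegrable (fun x => (F₂ x : ℂ) * g x) volume c d :=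
      ((Complex.continuous_ofReal.comp_continuousOn hF₂).mono hsubI).mul hgc |>.intervalIntegrable
    have hFw : IntervalIntegrable (fun x => (F x : ℂ) * w x) volume c d :=
      (hp.intervalIntegrable_from d hcd).continuousOn_mul hFc
    have e1 : inner ℂ (hψ.toLp _) (u : HalfLineL2 a) =
        ∫ x in c..d, (-(h : ℂ) ^ 2 * ((F₂ x : ℂ) * g x) + (V x : ℂ) * ((F x : ℂ) * g x)) := by
      rw [L2.inner_def, ← setIntegral_indicator_Ioc hac hcd]
      refine integral_congr_ae ?_
      filter_upwards [hψ.coeFn_toLp, hrep.ae_eq] with x h1 h2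
      rw [h1, h2, RCLike.inner_apply]
      by_cases hx : x ∈ Ioc c d
      · rw [indicator_of_mem hx, indicator_of_mem hx, Complex.conj_ofReal]
        push_cast; ring
      · rw [indicator_of_notMem hx, indicator_of_notMem hx, map_zero, mul_zero]
    have e2 : inner ℂ (hφ.toLp _) (T u) =
        ∫ x in c..d, (-(h : ℂ) ^ 2 * ((F x : ℂ) * w x) + (V x : ℂ) * ((F x : ℂ) * g x)) := by
      rw [L2.inner_def, ← setIntegral_indicator_Ioc hac hcd]
      refine integral_congr_ae ?_
      filter_upwards [hφ.coeFn_toLp, hrep.apply_ae_eq] with x h1 h2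
      rw [h1, h2, RCLike.inner_apply]
      by_cases hx : x ∈ Ioc c d
      · rw [indicator_of_mem hx, indicator_of_mem hx, Complex.conj_ofReal]
        ring
      · rw [indicator_of_notMem hx, indicator_of_notMem hx, map_zero, mul_zero]
    rw [e1, e2, intervalIntegral.integral_add (hF₂g.const_mul _) hVFg,
      intervalIntegral.integral_add (hFw.const_mul _) hVFg, intervalIntegral.integral_const_mul,
      intervalIntegral.integral_const_mul,
      IsPrimitiveFrom.integral_ofReal_mul_eq hcd hF hF₁ hF₂ hg hp hc hd hc₁ hd₁]
  exact ⟨φ, by rw [hφ1]; exact hφ.coeFn_toLp, by rw [hφ2]; exact hψ.coeFn_toLp⟩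

/-- A smooth profile on `[0, π]` with vanishing Cauchy data, close to `sin` in the energy norm:
`√(sin² + δ²) - δ` with small `δ`. -/
theorem exists_profile {h κ B : ℝ} (hB : h ^ 2 * (κ ^ 2 + 1 / 4) < B) :
    ∃ ψ ψ₁ : ℝ → ℝ, (∀ s, HasDerivAt ψ (ψ₁ s) s) ∧ ContDiff ℝ 1 ψ₁ ∧
      ψ 0 = 0 ∧ ψ Real.pi = 0 ∧ ψ₁ 0 = 0 ∧ ψ₁ Real.pi = 0 ∧
      ∫ s in (0 : ℝ)..Real.pi, (h ^ 2 * (ψ s / 2 + κ * ψ₁ s) ^ 2 - B * ψ s ^ 2) < 0 := by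
  obtain ⟨δ, hδ0, hδ⟩ : ∃ δ > 0, h ^ 2 * κ ^ 2 < (B - h ^ 2 / 4) * (1 - 4 * δ) := by
    have hcont : Tendsto (fun δ : ℝ => (B - h ^ 2 / 4) * (1 - 4 * δ)) (𝓝[>] 0)
        (𝓝 ((B - h ^ 2 / 4) * (1 - 4 * 0))) :=
      (Continuous.tendsto (by fun_prop) 0).mono_left nhdsWithin_le_nhds
    obtain ⟨δ, h1, h2⟩ := ((hcont.eventually_const_lt (by linarith : h ^ 2 * κ ^ 2 < _)).and
      self_mem_nhdsWithin).exists
    exact ⟨δ, h2, h1⟩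
  have hpos : ∀ s, 0 < Real.sin s ^ 2 + δ ^ 2 := fun s => by positivity
  set ψ : ℝ → ℝ := fun s => Real.sqrt (Real.sin s ^ 2 + δ ^ 2) - δ with hψ
  set ψ₁ : ℝ → ℝ := fun s => Real.sin s * Real.cos s / Real.sqrt (Real.sin s ^ 2 + δ ^ 2) with hψ₁
  have hd : ∀ s, HasDerivAt ψ (ψ₁ s) s := fun s => by
    have h1 := ((((Real.hasDerivAt_sin s).pow 2).add_const (δ ^ 2)).sqrt (hpos s).ne').sub_const δ
    refine h1.congr_deriv ?_
    simp only [hψ₁, Pi.pow_apply]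
    have := Real.sqrt_pos.mpr (hpos s)
    field_simp
    simp
    ring
  have hcd : ContDiff ℝ 1 ψ₁ :=
    (Real.contDiff_sin.mul Real.contDiff_cos).div
      (((Real.contDiff_sin.pow 2).add contDiff_const).sqrt fun s => (hpos s).ne')
      fun s => (Real.sqrt_pos.mpr (hpos s)).ne'
  have hψ0 : ψ 0 = 0 := by simp [hψ, Real.sqrt_sq hδ0.le]
  have hψπ : ψ Real.pi = 0 := by simp [hψ, Real.sqrt_sq hδ0.le]
  have hψc : Continuous ψ := continuous_iff_continuousAt.mpr fun s => (hd s).continuousAt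
  have hψ₁c : Continuous ψ₁ := hcd.continuous
  refine ⟨ψ, ψ₁, hd, hcd, hψ0, hψπ, by simp [hψ₁], by simp [hψ₁], ?_⟩
  have hii : ∀ {k : ℝ → ℝ}, Continuous k → IntervalIntegrable k volume 0 Real.pi :=
    fun hk => hk.intervalIntegrable _ _
  have hsplit : ∫ s in (0 : ℝ)..Real.pi, (h ^ 2 * (ψ s / 2 + κ * ψ₁ s) ^ 2 - B * ψ s ^ 2) =
      h ^ 2 * κ ^ 2 * (∫ s in (0 : ℝ)..Real.pi, ψ₁ s ^ 2) +
      h ^ 2 * κ / 2 * (∫ s in (0 : ℝ)..Real.pi, 2 * ψ s * ψ₁ s) -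
      (B - h ^ 2 / 4) * ∫ s in (0 : ℝ)..Real.pi, ψ s ^ 2 := by
    rw [← intervalIntegral.integral_const_mul, ← intervalIntegral.integral_const_mul,
      ← intervalIntegral.integral_const_mul, ← intervalIntegral.integral_add (hii (by fun_prop))
      (hii (by fun_prop)), ← intervalIntegral.integral_sub (hii (by fun_prop)) (hii (by fun_prop))]
    exact intervalIntegral.integral_congr fun s _ => by ring
  have hcross : ∫ s in (0 : ℝ)..Real.pi, 2 * ψ s * ψ₁ s = 0 := by
    rw [intervalIntegral.integral_eq_sub_of_hasDerivAt (f := fun s => ψ s ^ 2)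
      (fun s _ => ((hd s).pow 2).congr_deriv (by simp)) (hii (by fun_prop)), hψ0, hψπ]
    simp
  have hI₁ : ∫ s in (0 : ℝ)..Real.pi, ψ₁ s ^ 2 ≤ Real.pi / 2 := by
    calc ∫ s in (0 : ℝ)..Real.pi, ψ₁ s ^ 2 ≤ ∫ s in (0 : ℝ)..Real.pi, Real.cos s ^ 2 := by
          refine intervalIntegral.integral_mono_on Real.pi_pos.le (hii (by fun_prop))
            (hii (by fun_prop)) fun s _ => ?_
          simp only [hψ₁]
          rw [div_pow, Real.sq_sqrt (hpos s).le, div_le_iff₀ (hpos s)]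
          nlinarith [mul_nonneg (sq_nonneg (Real.cos s)) (sq_nonneg δ)]
      _ = Real.pi / 2 := by rw [integral_cos_sq]; simp
  have hI₀ : Real.pi / 2 * (1 - 4 * δ) ≤ ∫ s in (0 : ℝ)..Real.pi, ψ s ^ 2 := by
    calc Real.pi / 2 * (1 - 4 * δ) = ∫ s in (0 : ℝ)..Real.pi, (Real.sin s ^ 2 - 2 * δ) := by
          rw [intervalIntegral.integral_sub (hii (by fun_prop)) (hii (by fun_prop)),
            integral_sin_sq, intervalIntegral.integral_const]
          simp; ring
      _ ≤ _ := by
          refine intervalIntegral.integral_mono_on Real.pi_pos.le (hii (by fun_prop))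
            (hii (by fun_prop)) fun s _ => ?_
          have h1 : Real.sqrt (Real.sin s ^ 2 + δ ^ 2) ≤ 1 + δ := by
            rw [Real.sqrt_le_left (by positivity)]
            nlinarith [Real.sin_sq_le_one s]
          have h2 := Real.sq_sqrt (hpos s).le
          simp only [hψ]
          nlinarith
  have hBpos : 0 < B - h ^ 2 / 4 := by nlinarith [mul_nonneg (sq_nonneg h) (sq_nonneg κ)]
  rw [hsplit, hcross]
  have h1 := mul_le_mul_of_nonneg_left hI₁ (mul_nonneg (sq_nonneg h) (sq_nonneg κ))
  have h2 := mul_le_mul_of_nonneg_left hI₀ hBpos.le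
  have h3 := mul_lt_mul_of_pos_left hδ (half_pos Real.pi_pos)
  nlinarith

/-- A trial function on `[c, c * exp (π / κ)]` of negative energy for `-h² d²/dx² - B / x²`:
the profile in the variable `κ * log (x / c)`, multiplied by `√x`. -/
theorem exists_trial_profile {h κ B c : ℝ} (hB : h ^ 2 * (κ ^ 2 + 1 / 4) < B) (hκ : 0 < κ)
    (hc : 0 < c) : ∃ F F₁ F₂ : ℝ → ℝ, IsPrimitiveFrom c F F₁ ∧ IsPrimitiveFrom c F₁ F₂ ∧
      ContinuousOn F₂ (Ici c) ∧ F c = 0 ∧ F (c * Real.exp (Real.pi / κ)) = 0 ∧ F₁ c = 0 ∧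
      F₁ (c * Real.exp (Real.pi / κ)) = 0 ∧
      ∫ x in c..c * Real.exp (Real.pi / κ), (h ^ 2 * F₁ x ^ 2 - B / x ^ 2 * F x ^ 2) < 0 := by
  obtain ⟨ψ, ψ₁, hd, hcd, h0, hπ, h0₁, hπ₁, hneg⟩ := exists_profile hB
  set d := c * Real.exp (Real.pi / κ) with hdd
  have hcd' : c ≤ d := by
    have := Real.one_le_exp (div_pos Real.pi_pos hκ).le
    nlinarith
  set σ : ℝ → ℝ := fun x => κ * Real.log (x / c) with hσ
  have hσc : σ c = 0 := by simp [hσ, hc.ne']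
  have hσd : σ d = Real.pi := by
    simp only [hσ, hdd]
    rw [mul_div_cancel_left₀ _ hc.ne', Real.log_exp, mul_div_cancel₀ _ hκ.ne']
  have hσ' : ∀ x, 0 < x → HasDerivAt σ (κ / x) x := fun x hx => by
    have h1 := (((hasDerivAt_id x).div_const c).log (by simp; grind)).const_mul κ
    refine h1.congr_deriv ?_
    simp only [id]
    field_simp
  have hσcd : ContDiffOn ℝ 1 σ (Ioi 0) :=
    contDiffOn_const.mul ((contDiffOn_id.div_const c).log fun x hx => by
      have : 0 < x := hx
      simp only [id]; positivity)
  set F : ℝ → ℝ := fun x => Real.sqrt x * ψ (σ x) with hF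
  set F₁ : ℝ → ℝ := fun x => (ψ (σ x) / 2 + κ * ψ₁ (σ x)) / Real.sqrt x with hF₁
  have hψcd : ContDiff ℝ 1 ψ := contDiff_one_iff_deriv.mpr
    ⟨fun s => (hd s).differentiableAt, by
      rw [show deriv ψ = ψ₁ from funext fun s => (hd s).deriv]; exact hcd.continuous⟩
  have hFd : ∀ x, 0 < x → HasDerivAt F (F₁ x) x := fun x hx => by
    have h1 := ((hasDerivAt_id x).sqrt hx.ne').mul ((hd (σ x)).comp x (hσ' x hx))
    refine h1.congr_deriv ?_
    simp only [hF₁, id, Function.comp]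
    have hs := Real.sqrt_pos.mpr hx
    have hs2 : x = Real.sqrt x ^ 2 := (Real.sq_sqrt hx.le).symm
    generalize ψ (σ x) = y at *
    generalize ψ₁ (σ x) = y₁ at *
    generalize Real.sqrt x = t at *
    subst hs2
    field_simp
  have hF₁cd : ContDiffOn ℝ 1 F₁ (Ioi 0) := by
    refine ContDiffOn.div (((hψcd.comp_contDiffOn hσcd).div_const 2).add
      (contDiffOn_const.mul (hcd.comp_contDiffOn hσcd)))
      (contDiffOn_id.sqrt fun x hx => ne_of_gt hx) fun x hx => (Real.sqrt_pos.mpr hx).ne'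
  have hF₁d : ∀ x, 0 < x → HasDerivAt F₁ (deriv F₁ x) x := fun x hx =>
    ((hF₁cd.differentiableOn one_ne_zero).differentiableAt (Ioi_mem_nhds hx)).hasDerivAt
  have hF₂c : ContinuousOn (deriv F₁) (Ioi 0) :=
    hF₁cd.continuousOn_deriv_of_isOpen isOpen_Ioi le_rfl
  have hsub : Ici c ⊆ Ioi 0 := fun x hx => hc.trans_le hx
  refine ⟨F, F₁, deriv F₁,
    .of_hasDerivAt (fun x hx => hFd x (hc.trans_le hx)) (hF₁cd.continuousOn.mono hsub),
    .of_hasDerivAt (fun x hx => hF₁d x (hc.trans_le hx)) (hF₂c.mono hsub), hF₂c.mono hsub,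
    ?_, ?_, ?_, ?_, ?_⟩
  · simp [hF, hσc, h0]
  · simp [hF, hσd, hπ]
  · simp [hF₁, hσc, h0, h0₁]
  · simp [hF₁, hσd, hπ, hπ₁]
  · set Φ : ℝ → ℝ := fun s => h ^ 2 * (ψ s / 2 + κ * ψ₁ s) ^ 2 - B * ψ s ^ 2 with hΦ
    have hψ₁c := hcd.continuous
    have hψc := hψcd.continuous
    have hΦc : Continuous Φ := by fun_prop
    have hpos : ∀ x ∈ uIcc c d, 0 < x := fun x hx => by
      rw [uIcc_of_le hcd'] at hx; exact hc.trans_le hx.1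
    have hsubst := intervalIntegral.integral_comp_mul_deriv (a := c) (b := d) (f := σ)
      (f' := fun x => κ / x) (g := Φ) (fun x hx => hσ' x (hpos x hx))
      (continuousOn_const.div continuousOn_id fun x hx => (hpos x hx).ne') hΦc
    rw [hσc, hσd] at hsubst
    have heq : ∫ x in c..d, (h ^ 2 * F₁ x ^ 2 - B / x ^ 2 * F x ^ 2) =
        κ⁻¹ * ∫ x in c..d, (Φ ∘ σ) x * (κ / x) := by
      rw [← intervalIntegral.integral_const_mul]
      refine intervalIntegral.integral_congr fun x hx => ?_
      have hx0 := hpos x hx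
      simp only [hF, hF₁, hΦ, Function.comp, div_pow, mul_pow, Real.sq_sqrt hx0.le]
      field_simp
    rw [heq, hsubst]
    exact mul_neg_of_pos_of_neg (inv_pos.mpr hκ) hneg

/-- The lower bound for the number of eigenvalues: `n` consecutive trial functions fit into
`[R, R * exp (n * π / κ)]`. -/
theorem IsSchrodingerRealization.le_countingFunction (hT : IsSchrodingerRealization a h V T)
    (hV : MemLp V ⊤ (volume.restrict (Ioi a))) {R κ B E : ℝ} {M n : ℕ} (ha : 0 < a) (haR : a ≤ R)
    (hM : HasFormIndexLE T E M) (hκ : 0 < κ) (hB : h ^ 2 * (κ ^ 2 + 1 / 4) < B)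
    (hq : ∀ᵐ x, x ∈ Ioc R (R * Real.exp (n * (Real.pi / κ))) → V x - E ≤ -(B / x ^ 2)) :
    n ≤ countingFunction T E := by
  have hR0 := ha.trans_le haR
  have hπκ : 0 < Real.pi / κ := div_pos Real.pi_pos hκ
  set c : ℕ → ℝ := fun i => R * Real.exp (i * (Real.pi / κ)) with hc
  have hcmono : Monotone c := fun i j hij => by simp only [hc]; gcongr
  have hc0 : c 0 = R := by simp [hc]
  have hRc : ∀ i, R ≤ c i := fun i => by
    conv_lhs => rw [← hc0]
    exact hcmono (Nat.zero_le i)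
  have hcs : ∀ i, c (i + 1) = c i * Real.exp (Real.pi / κ) := fun i => by
    simp only [hc]
    rw [mul_assoc, ← Real.exp_add]
    push_cast
    ring_nf
  have hac : ∀ i, a ≤ c i := fun i => haR.trans (hRc i)
  choose F F₁ F₂ hF hF₁ hF₂ hz hz' hz₁ hz₁' hneg using fun i : Fin n =>
    exists_trial_profile hB hκ (hR0.trans_le (hRc i))
  simp only [← hcs] at hz' hz₁' hneg
  have hle : ∀ i : ℕ, c i ≤ c (i + 1) := fun i => hcmono i.le_succ
  choose φ hφ hTφ using fun i : Fin n => hT.exists_trial hV (hac i) (hle i) (hF i) (hF₁ i)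
    (hF₂ i) (hz i) (hz' i) (hz₁ i) (hz₁' i)
  have hdisj : ∀ i j : Fin n, i ≠ j → ∀ x, x ∈ Ioc (c i) (c (i + 1)) →
      x ∉ Ioc (c j) (c (j + 1)) := by
    intro i j hij x hx hx'
    rcases lt_or_gt_of_ne hij with hlt | hlt
    · exact absurd (hx.2.trans (hcmono (Nat.succ_le_of_lt hlt))) (not_le.mpr hx'.1)
    · exact absurd (hx'.2.trans (hcmono (Nat.succ_le_of_lt hlt))) (not_le.mpr hx.1)
  have hinner : ∀ (u v : HalfLineL2 a) (k l : ℝ → ℂ) (i j : Fin n), i ≠ j →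
      (u =ᵐ[volume.restrict (Ioi a)] (Ioc (c i) (c (i + 1))).indicator k) →
      (v =ᵐ[volume.restrict (Ioi a)] (Ioc (c j) (c (j + 1))).indicator l) →
      inner ℂ u v = 0 := by
    intro u v k l i j hij hu hv
    rw [L2.inner_def]
    refine integral_eq_zero_of_ae ?_
    filter_upwards [hu, hv] with x h1 h2
    rw [h1, h2]
    by_cases hx : x ∈ Ioc (c i) (c (i + 1))
    · rw [indicator_of_notMem (hdisj i j hij x hx), inner_zero_right]; rfl
    · rw [indicator_of_notMem hx, inner_zero_left]; rfl
  refine hT.1.le_countingFunction hM φ (fun i j hij => hinner _ _ _ _ i j hij (hφ i) (hφ j))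
    (fun i j hij => hinner _ _ _ _ i j hij (hTφ i) (hφ j)) fun i => ?_
  have hre : ∀ (u v : HalfLineL2 a) (k l : ℝ → ℝ),
      (u =ᵐ[volume.restrict (Ioi a)] (Ioc (c i) (c (i + 1))).indicator fun x => (k x : ℂ)) →
      (v =ᵐ[volume.restrict (Ioi a)] (Ioc (c i) (c (i + 1))).indicator fun x => (l x : ℂ)) →
      (inner ℂ u v).re = ∫ x in c i..c (i + 1), k x * l x := by
    intro u v k l hu hv
    have him : ∫ x in Ioi a, (u x).im * (v x).im = 0 := by
      refine integral_eq_zero_of_ae ?_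
      filter_upwards [hu] with x h1
      rw [h1]
      by_cases hx : x ∈ Ioc (c i) (c (i + 1))
      · rw [indicator_of_mem hx]; simp
      · rw [indicator_of_notMem hx]; simp
    rw [HalfLineL2.re_inner_eq, him, add_zero, ← setIntegral_indicator_Ioc (hac i) (hle i)]
    refine integral_congr_ae ?_
    filter_upwards [hu, hv] with x h1 h2
    rw [h1, h2]
    by_cases hx : x ∈ Ioc (c i) (c (i + 1))
    · simp only [indicator_of_mem hx, Complex.ofReal_re]
    · simp only [indicator_of_notMem hx, Complex.zero_re, mul_zero]
  have hnorm : ‖(φ i : HalfLineL2 a)‖ ^ 2 =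
      (inner ℂ (φ i : HalfLineL2 a) (φ i : HalfLineL2 a)).re := by
    rw [inner_self_eq_norm_sq_to_K]; simp [← Complex.ofReal_pow]
  rw [hnorm, hre _ _ _ _ (hTφ i) (hφ i), hre _ _ _ _ (hφ i) (hφ i)]
  have hpos : ∀ x ∈ uIcc (c i) (c (i + 1)), 0 < x := fun x hx => by
    rw [uIcc_of_le (hle i)] at hx; exact (hR0.trans_le (hRc i)).trans_le hx.1
  have hsubI : uIcc (c i) (c (i + 1)) ⊆ Ici (c i) := by
    rw [uIcc_of_le (hle i)]; exact fun x hx => hx.1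
  have hFc := (hF i).continuousOn.mono hsubI
  have hF₁c := (hF₁ i).continuousOn.mono hsubI
  have hF₂c := (hF₂ i).mono hsubI
  have hVi : IntervalIntegrable V volume (c i) (c (i + 1)) := by
    rw [intervalIntegrable_iff_integrableOn_Ioc_of_le (hle i)]
    exact ((hV.mono_measure (Measure.restrict_mono
      (fun x hx => lt_of_le_of_lt (hac i) hx.1 : Ioc (c i) (c (i + 1)) ⊆ Ioi a)
      le_rfl)).mono_exponent le_top).integrable le_rfl
  have i1 : IntervalIntegrable (fun x => F₂ i x * F i x) volume (c i) (c (i + 1)) :=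
    (hF₂c.mul hFc).intervalIntegrable
  have i2 : IntervalIntegrable (fun x => F₁ i x * F₁ i x) volume (c i) (c (i + 1)) :=
    (hF₁c.mul hF₁c).intervalIntegrable
  have i3 : IntervalIntegrable (fun x => V x * (F i x * F i x)) volume (c i) (c (i + 1)) :=
    hVi.mul_continuousOn (hFc.mul hFc)
  have i4 : IntervalIntegrable (fun x => F i x * F i x) volume (c i) (c (i + 1)) :=
    (hFc.mul hFc).intervalIntegrable
  have i5 : IntervalIntegrable (fun x => B / x ^ 2 * (F i x) ^ 2) volume (c i) (c (i + 1)) :=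
    ((continuousOn_const.div (continuousOn_id.pow 2) fun x hx => pow_ne_zero _
      (hpos x hx).ne').mul (hFc.pow 2)).intervalIntegrable
  have i6 : IntervalIntegrable (fun x => h ^ 2 * (F₁ i x) ^ 2) volume (c i) (c (i + 1)) :=
    (continuousOn_const.mul (hF₁c.pow 2)).intervalIntegrable
  have hibp := (hF₁ i).integral_mul_add (hF i) le_rfl (hle i)
  rw [hz i, hz' i, intervalIntegral.integral_add i1 i2] at hibp
  have hlow : (∫ x in c i..c (i + 1), V x * (F i x * F i x)) -
      E * (∫ x in c i..c (i + 1), F i x * F i x) ≤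
      -∫ x in c i..c (i + 1), B / x ^ 2 * (F i x) ^ 2 := by
    rw [← intervalIntegral.integral_const_mul, ← intervalIntegral.integral_sub i3 (i4.const_mul E),
      ← intervalIntegral.integral_neg]
    refine intervalIntegral.integral_mono_ae_restrict (hle i) (i3.sub (i4.const_mul E)) i5.neg ?_
    rw [EventuallyLE, ← restrict_Ioc_eq_restrict_Icc, ae_restrict_iff' measurableSet_Ioc]
    filter_upwards [hq] with x hx hxm
    have h1 := hx ⟨(hRc i).trans_lt hxm.1, hxm.2.trans (hcmono (Nat.succ_le_of_lt i.2))⟩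
    calc V x * (F i x * F i x) - E * (F i x * F i x) = (V x - E) * F i x ^ 2 := by ring
      _ ≤ -(B / x ^ 2) * F i x ^ 2 := mul_le_mul_of_nonneg_right h1 (sq_nonneg _)
      _ = _ := by ring
  have hmain := hneg i
  rw [intervalIntegral.integral_sub i6 i5, intervalIntegral.integral_const_mul] at hmain
  have hexp : ∫ x in c i..c (i + 1), (-h ^ 2 * F₂ i x + V x * F i x) * F i x =
      -h ^ 2 * (∫ x in c i..c (i + 1), F₂ i x * F i x) +
        ∫ x in c i..c (i + 1), V x * (F i x * F i x) := by
    rw [← intervalIntegral.integral_const_mul, ← intervalIntegral.integral_add (i1.const_mul _) i3]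
    exact intervalIntegral.integral_congr fun x _ => by ring
  have hpp : ∫ x in c i..c (i + 1), F₁ i x ^ 2 = ∫ x in c i..c (i + 1), F₁ i x * F₁ i x := by
    simp only [sq]
  rw [hexp]
  nlinarith

end Trial

/-! ### Asymptotics -/

section Asymptotics

variable {a h : ℝ} {V : ℝ → ℝ} {T : HalfLineL2 a →ₗ.[ℂ] HalfLineL2 a}

theorem IsSchrodingerRealization.exists_hasFormIndexLE (hT : IsSchrodingerRealization a h V T)
    (ha : 0 < a) (hh : 0 < h) {K R b e ρ : ℝ} (hK : 0 ≤ K) (haR : a ≤ R) (hb : 0 < b) (he : 0 < e)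
    (hρ : 0 < ρ) (heρ : e * ρ ^ 2 = 1) (hVK : ∀ᵐ x, a < x → -K ≤ V x)
    (hVb : ∀ᵐ x, R < x → -(b ^ 2 / x ^ 2) ≤ V x) :
    ∃ M : ℕ, HasFormIndexLE T (-e) M ∧
      (M : ℝ) ≤ (Real.sqrt K * R * Real.log (R / a) + b * Real.log (max R (b * ρ) / R)) /
        (Real.pi * h) + 4 := by
  have hR0 := ha.trans_le haR
  set S := max R (b * ρ) with hS
  set κ₀ := Real.sqrt K * R / h with hκ₀
  set κ₁ := b / h with hκ₁
  have hκ₀' : 0 ≤ κ₀ := by positivity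
  have hκ₁' : 0 ≤ κ₁ := by positivity
  have hRS : R ≤ S := le_max_left _ _
  have hL₀ : 0 ≤ Real.log (R / a) := Real.log_nonneg ((one_le_div ha).mpr haR)
  have hL₁ : 0 ≤ Real.log (S / R) := Real.log_nonneg ((one_le_div hR0).mpr hRS)
  have hfl : ∀ y : ℝ, y < ((⌊y / Real.pi⌋₊ + 1 : ℕ) : ℝ) * Real.pi := fun y => by
    rw [← div_lt_iff₀ Real.pi_pos]
    push_cast
    exact Nat.lt_floor_add_one _
  refine ⟨_, hT.hasFormIndexLE (R := R) (S := S) (κ₀ := κ₀) (κ₁ := κ₁) (A₀ := K * R ^ 2)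
    (A₁ := b ^ 2) ha haR hRS (Nat.succ_pos _) (Nat.succ_pos _) hκ₀' hκ₁' (hfl _) (hfl _)
    ?_ ?_ ?_ ?_ ?_, ?_⟩
  · rw [hκ₀, mul_add, div_pow, mul_pow, Real.sq_sqrt hK, mul_div_cancel₀ _ (by positivity)]
    nlinarith [sq_nonneg h]
  · rw [hκ₁, mul_add, div_pow, mul_div_cancel₀ _ (by positivity)]
    nlinarith [sq_nonneg h]
  · filter_upwards [hVK] with x hx hxm
    have hx0 := ha.trans hxm.1
    have h1 : K ≤ K * R ^ 2 / x ^ 2 := by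
      rw [le_div_iff₀ (by positivity)]
      exact mul_le_mul_of_nonneg_left (pow_le_pow_left₀ hx0.le hxm.2 2) hK
    linarith [hx hxm.1]
  · filter_upwards [hVb] with x hx hxm
    linarith [hx hxm.1]
  · filter_upwards [hVb] with x hx hxm
    have hxm' : S < x := hxm
    have hx0 : 0 < x := hR0.trans (hRS.trans_lt hxm')
    have hxρ : b * ρ ≤ x := (le_max_right _ _).trans hxm'.le
    have h1 : b ^ 2 / x ^ 2 ≤ e := by
      rw [div_le_iff₀ (by positivity)]
      calc b ^ 2 = e * (b * ρ) ^ 2 := by rw [mul_pow]; linear_combination -b ^ 2 * heρ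
        _ ≤ e * x ^ 2 := mul_le_mul_of_nonneg_left (pow_le_pow_left₀ (by positivity) hxρ 2) he.le
    linarith [hx (hRS.trans_lt hxm')]
  · have h0 := Nat.floor_le (div_nonneg (mul_nonneg hκ₀' hL₀) Real.pi_pos.le)
    have h1 := Nat.floor_le (div_nonneg (mul_nonneg hκ₁' hL₁) Real.pi_pos.le)
    have h2 : (Real.sqrt K * R * Real.log (R / a) + b * Real.log (S / R)) / (Real.pi * h) =
        κ₀ * Real.log (R / a) / Real.pi + κ₁ * Real.log (S / R) / Real.pi := by
      rw [hκ₀, hκ₁]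
      field_simp
    rw [h2]
    push_cast
    linarith

theorem IsSchrodingerRealization.exists_le_countingFunction
    (hT : IsSchrodingerRealization a h V T) (hV : MemLp V ⊤ (volume.restrict (Ioi a)))
    (ha : 0 < a) (hh : 0 < h) {R b B s e ρ : ℝ} {M : ℕ} (hM : HasFormIndexLE T (-e) M)
    (haR : a ≤ R) (hb : 0 < b) (he : 0 < e) (heρ : e * ρ ^ 2 = 1)
    (hB : b ^ 2 + h ^ 2 / 4 < B) (hRρ : R ≤ s * ρ)
    (hVB : ∀ᵐ x, R < x → V x ≤ -((B + s ^ 2) / x ^ 2)) :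
    ∃ n : ℕ, n ≤ countingFunction T (-e) ∧
      b * Real.log (s * ρ / R) / (Real.pi * h) - 1 ≤ (n : ℝ) := by
  have hR0 := ha.trans_le haR
  have hL : 0 ≤ Real.log (s * ρ / R) := Real.log_nonneg ((one_le_div hR0).mpr hRρ)
  have hκ : 0 < b / h := by positivity
  refine ⟨⌊b * Real.log (s * ρ / R) / (Real.pi * h)⌋₊,
    hT.le_countingFunction hV (B := B) ha haR hM hκ ?_ ?_, (Nat.sub_one_lt_floor _).le⟩
  · rw [mul_add, div_pow, mul_div_cancel₀ _ (by positivity)]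
    linarith
  · filter_upwards [hVB] with x hx hxm
    have hx0 := hR0.trans hxm.1
    have hn := Nat.floor_le (div_nonneg (mul_nonneg hb.le hL) (mul_pos Real.pi_pos hh).le)
    have hxρ : x ≤ s * ρ := by
      refine hxm.2.trans ?_
      rw [← le_div_iff₀' hR0, ← Real.le_log_iff_exp_le (div_pos (hR0.trans_le hRρ) hR0)]
      calc _ ≤ b * Real.log (s * ρ / R) / (Real.pi * h) * (Real.pi / (b / h)) :=
            mul_le_mul_of_nonneg_right hn (div_pos Real.pi_pos hκ).le
        _ = Real.log (s * ρ / R) := by field_simp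
    have h1 : e ≤ s ^ 2 / x ^ 2 := by
      rw [le_div_iff₀ (by positivity)]
      calc e * x ^ 2 ≤ e * (s * ρ) ^ 2 :=
            mul_le_mul_of_nonneg_left (pow_le_pow_left₀ hx0.le hxρ 2) he.le
        _ = s ^ 2 := by rw [mul_pow]; linear_combination s ^ 2 * heρ
    have h2 := hx hxm.1
    rw [add_div] at h2
    linarith

end Asymptotics

theorem proposition3 (a : ℝ) (ha : 0 < a) (v : ℝ → ℝ)
    (hv : MemLp v ⊤ (volume.restrict (Ioi a)))
    (hvo : v =o[atTop ⊓ ae volume] fun x : ℝ => 1 / x ^ 2)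
    (T : ℝ → (HalfLineL2 a →ₗ.[ℂ] HalfLineL2 a))
    (hT : ∀ h : ℝ, 0 < h →
      IsSchrodingerRealization a h (fun x => -(1 / (4 * x ^ 2)) + v x) (T h))
    (γ : ℝ) (hγ : γ ∈ Ioo (0 : ℝ) 2) (C : ℝ) (hC : 0 < C) :
    (∀ h : ℝ, 0 < h →
      countingFunction (T h) (-(C * h ^ γ)) ≠ ⊤ ∧
      countingFunction (T h) (-(C * h ^ γ)) = eigenvalueCount (T h) (-(C * h ^ γ))) ∧
    (fun h : ℝ => ((countingFunction (T h) (-(C * h ^ γ))).toNat : ℝ))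
      ~[𝓝[>] (0 : ℝ)] fun h : ℝ => γ / (4 * Real.pi) * (|Real.log h| / h) := by
  have hγ0 : 0 < γ := hγ.1
  set V : ℝ → ℝ := fun x => -(1 / (4 * x ^ 2)) + v x with hVdef
  obtain ⟨K, hK0, hVK⟩ : ∃ K ≥ 0, ∀ᵐ x, a < x → |V x| ≤ K := by
    refine ⟨1 / (4 * a ^ 2) + (eLpNorm v ⊤ (volume.restrict (Ioi a))).toReal, by positivity, ?_⟩
    have h1 := ae_le_eLpNormEssSup (f := v) (μ := volume.restrict (Ioi a))
    rw [ae_restrict_iff' measurableSet_Ioi] at h1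
    filter_upwards [h1] with x hx hxa
    have hx0 := ha.trans hxa
    have h2 : |v x| ≤ (eLpNorm v ⊤ (volume.restrict (Ioi a))).toReal := by
      have h3 : ‖v x‖ₑ.toReal ≤ (eLpNorm v ⊤ (volume.restrict (Ioi a))).toReal :=
        ENNReal.toReal_mono hv.eLpNorm_ne_top (by rw [eLpNorm_exponent_top]; exact hx hxa)
      rwa [toReal_enorm, Real.norm_eq_abs] at h3
    have h4 : |-(1 / (4 * x ^ 2))| ≤ 1 / (4 * a ^ 2) := by
      rw [abs_neg, abs_of_nonneg (by positivity)]
      gcongr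
    exact (abs_add_le _ _).trans (add_le_add h4 h2)
  have hVm : MemLp V ⊤ (volume.restrict (Ioi a)) := by
    refine memLp_top_of_bound (AEStronglyMeasurable.add ?_ hv.aestronglyMeasurable) K ?_
    · exact (by fun_prop : Measurable fun x : ℝ => -(1 / (4 * x ^ 2))).aestronglyMeasurable
    · rw [ae_restrict_iff' measurableSet_Ioi]
      exact hVK
  have hVK' : ∀ᵐ x, a < x → -K ≤ V x := by
    filter_upwards [hVK] with x hx hxa
    exact (abs_le.mp (hx hxa)).1
  have hfar : ∀ δ > 0, ∃ R ≥ a, ∀ᵐ x, R < x → |v x| ≤ δ / x ^ 2 := by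
    intro δ hδ
    have h1 := hvo.bound hδ
    rw [eventually_inf] at h1
    obtain ⟨s, hs, t, ht, hst⟩ := h1
    obtain ⟨R, hR⟩ := mem_atTop_sets.mp hs
    refine ⟨max R a, le_max_right _ _, ?_⟩
    filter_upwards [ht] with x hx hxR
    have h2 := hst x ⟨hR x ((le_max_left _ _).trans hxR.le), hx⟩
    rw [Real.norm_eq_abs, Real.norm_of_nonneg (by positivity)] at h2
    rwa [mul_one_div] at h2
  -- The scale `ρ h = (C h ^ γ) ^ (-1/2)` at which `1 / x²` and `C h ^ γ` are comparable.
  set ρ : ℝ → ℝ := fun h => Real.exp (-(Real.log C + γ * Real.log h) / 2) with hρdef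
  have hρ0 : ∀ h, 0 < ρ h := fun h => Real.exp_pos _
  have heρ : ∀ h, 0 < h → C * h ^ γ * ρ h ^ 2 = 1 := by
    intro h hh
    have h1 : ρ h ^ 2 = Real.exp (-(Real.log C + γ * Real.log h)) := by
      rw [hρdef, ← Real.exp_nat_mul]; congr 1; push_cast; ring
    have h2 : C * h ^ γ = Real.exp (Real.log C + γ * Real.log h) := by
      rw [Real.exp_add, Real.exp_log hC, Real.rpow_def_of_pos hh, mul_comm γ]
    rw [h1, h2, ← Real.exp_add, add_neg_cancel, Real.exp_zero]
  have he0 : ∀ h, 0 < h → 0 < C * h ^ γ := fun h hh => by positivity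
  have hlow : ∀ b : ℝ, 1 / 2 < b → ∃ R ≥ a, ∀ᵐ x, R < x → -(b ^ 2 / x ^ 2) ≤ V x := by
    intro b hb
    obtain ⟨R, hR, hvR⟩ := hfar (b ^ 2 - 1 / 4) (by nlinarith)
    refine ⟨R, hR, ?_⟩
    filter_upwards [hvR] with x hx hxR
    have h1 := (abs_le.mp (hx hxR)).1
    have hx0 : 0 < x := (ha.trans_le hR).trans hxR
    have h2 : (b ^ 2 - 1 / 4) / x ^ 2 = b ^ 2 / x ^ 2 - 1 / (4 * x ^ 2) := by field_simp
    simp only [hVdef]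
    linarith
  have hindex : ∀ h, 0 < h → ∃ M, HasFormIndexLE (T h) (-(C * h ^ γ)) M := by
    intro h hh
    obtain ⟨R, hR, hVR⟩ := hlow 1 (by norm_num)
    obtain ⟨M, hM, -⟩ := (hT h hh).exists_hasFormIndexLE ha hh hK0 hR one_pos (he0 h hh) (hρ0 h)
      (heρ h hh) hVK' hVR
    exact ⟨M, hM⟩
  have hfin : ∀ h, 0 < h → countingFunction (T h) (-(C * h ^ γ)) ≠ ⊤ := fun h hh => by
    obtain ⟨M, hM⟩ := hindex h hh
    exact ne_top_of_le_ne_top (ENat.natCast_ne_top M) ((hT h hh).1.countingFunction_le_and_eq hM).1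
  refine ⟨fun h hh => ⟨hfin h hh, ?_⟩, ?_⟩
  · obtain ⟨M, hM⟩ := hindex h hh
    exact ((hT h hh).1.countingFunction_le_and_eq hM).2
  set N : ℝ → ℝ := fun h => ((countingFunction (T h) (-(C * h ^ γ))).toNat : ℝ) with hN
  set l : ℝ → ℝ := fun h => -Real.log h with hl
  have hltop : Tendsto l (𝓝[>] 0) atTop := tendsto_neg_atBot_atTop.comp Real.tendsto_log_nhdsGT_zero
  have hpos : ∀ᶠ h : ℝ in 𝓝[>] 0, 0 < h ∧ h < 1 :=
    (eventually_mem_nhdsWithin.and (eventually_nhdsWithin_of_eventually_nhds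
      (eventually_lt_nhds one_pos)))
  have hlogρ : ∀ h, Real.log (ρ h) = (γ * l h - Real.log C) / 2 := fun h => by
    rw [hρdef, Real.log_exp]; simp only [hl]; ring
  have hρtop : Tendsto ρ (𝓝[>] 0) atTop := by
    refine Real.tendsto_exp_atTop.comp ?_
    have h1 := (((hltop.const_mul_atTop hγ0)).atTop_add
      (tendsto_const_nhds (x := -Real.log C))).atTop_div_const (two_pos (α := ℝ))
    refine h1.congr fun h => ?_
    simp only [hl]; ring
  have hupper : ∀ b : ℝ, 1 / 2 < b → ∀ᶠ h in 𝓝[>] 0, N h * h ≤ b * γ / (2 * Real.pi) * l h := by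
    intro b hb
    obtain ⟨b', hb', hb'b⟩ := exists_between hb
    have hb'0 : 0 < b' := by linarith
    obtain ⟨R, hR, hVR⟩ := hlow b' hb'
    have hR0 := ha.trans_le hR
    -- The leading terms leave the room `(b - b') * γ * l h / (2 * π)` for the bounded ones.
    have hbig : ∀ᶠ h in 𝓝[>] 0, (Real.sqrt K * R * Real.log (R / a) +
        b' * (Real.log (b' / R) - Real.log C / 2)) / Real.pi + 4 ≤
        (b - b') * γ / (2 * Real.pi) * l h :=
      (hltop.const_mul_atTop (by have := Real.pi_pos; have := sub_pos.mpr hb'b; positivity)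
        ).eventually_ge_atTop _
    filter_upwards [hpos, hbig, hρtop.eventually_ge_atTop (R / b')] with h hh hbh hρh
    obtain ⟨M, hM, hMle⟩ := (hT h hh.1).exists_hasFormIndexLE ha hh.1 hK0 hR hb'0 (he0 h hh.1)
      (hρ0 h) (heρ h hh.1) hVK' hVR
    have hmax : max R (b' * ρ h) = b' * ρ h :=
      max_eq_right (by rw [mul_comm]; exact (div_le_iff₀ hb'0).mp hρh)
    have hlog : Real.log (b' * ρ h / R) =
        Real.log (b' / R) + (γ * l h - Real.log C) / 2 := by
      rw [mul_div_right_comm, Real.log_mul (by positivity) (hρ0 h).ne', hlogρ]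
    rw [hmax, hlog] at hMle
    have hNM : N h ≤ M := by
      have := ENat.toNat_le_of_le_natCast ((hT h hh.1).1.countingFunction_le_and_eq hM).1
      simp only [hN]
      exact_mod_cast this
    calc N h * h ≤ M * h := mul_le_mul_of_nonneg_right hNM hh.1.le
      _ ≤ _ := mul_le_mul_of_nonneg_right hMle hh.1.le
      _ = (Real.sqrt K * R * Real.log (R / a) +
          b' * (Real.log (b' / R) - Real.log C / 2)) / Real.pi + 4 * h +
          b' * γ / (2 * Real.pi) * l h := by
        have := hh.1.ne'
        have := Real.pi_pos.ne'
        field_simp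
        ring
      _ ≤ (b - b') * γ / (2 * Real.pi) * l h + b' * γ / (2 * Real.pi) * l h := by
        linarith [hh.2]
      _ = _ := by ring
  have hlower : ∀ b : ℝ, 0 < b → b < 1 / 2 →
      ∀ᶠ h in 𝓝[>] 0, b * γ / (2 * Real.pi) * l h ≤ N h * h := by
    intro b hb0 hb
    obtain ⟨b', hbb', hb'⟩ := exists_between hb
    have hb'0 : 0 < b' := hb0.trans hbb'
    -- `1/4 - b'²` is split between `v`, the spectral parameter and the term `h² / 4`.
    set δ := (1 / 4 - b' ^ 2) / 4 with hδ
    have hδ0 : 0 < δ := by rw [hδ]; nlinarith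
    obtain ⟨R, hR, hvR⟩ := hfar δ hδ0
    have hR0 := ha.trans_le hR
    have hs0 : 0 < Real.sqrt δ := Real.sqrt_pos.mpr hδ0
    have hVR : ∀ᵐ x, R < x → V x ≤ -((b' ^ 2 + 2 * δ + Real.sqrt δ ^ 2) / x ^ 2) := by
      filter_upwards [hvR] with x hx hxR
      have h1 := (abs_le.mp (hx hxR)).2
      have hx0 : 0 < x := hR0.trans hxR
      have h2 : (b' ^ 2 + 2 * δ + Real.sqrt δ ^ 2) / x ^ 2 = 1 / (4 * x ^ 2) - δ / x ^ 2 := by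
        rw [Real.sq_sqrt hδ0.le, hδ]
        field_simp
        ring
      rw [h2]
      simp only [hVdef]
      linarith
    have hbig : ∀ᶠ h in 𝓝[>] 0, 1 - b' * (Real.log (Real.sqrt δ / R) - Real.log C / 2) / Real.pi ≤
        (b' - b) * γ / (2 * Real.pi) * l h :=
      (hltop.const_mul_atTop (by have := Real.pi_pos; have := sub_pos.mpr hbb'; positivity)
        ).eventually_ge_atTop _
    have hsmall : ∀ᶠ h : ℝ in 𝓝[>] 0, h ^ 2 / 4 < 2 * δ := by
      have h1 : Tendsto (fun h : ℝ => h ^ 2 / 4) (𝓝[>] 0) (𝓝 (0 ^ 2 / 4)) :=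
        (Continuous.tendsto (by fun_prop) 0).mono_left nhdsWithin_le_nhds
      exact h1.eventually_lt_const (by rw [zero_pow two_ne_zero, zero_div]; positivity)
    filter_upwards [hpos, hbig, hρtop.eventually_ge_atTop (R / Real.sqrt δ), hsmall]
      with h hh hbh hρh hsm
    obtain ⟨M, hM⟩ := hindex h hh.1
    obtain ⟨n, hn, hnle⟩ := (hT h hh.1).exists_le_countingFunction hVm ha hh.1 hM hR hb'0
      (he0 h hh.1) (heρ h hh.1) (by linarith : b' ^ 2 + h ^ 2 / 4 < b' ^ 2 + 2 * δ)
      (by rw [mul_comm]; exact (div_le_iff₀ hs0).mp hρh) hVR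
    have hlog : Real.log (Real.sqrt δ * ρ h / R) =
        Real.log (Real.sqrt δ / R) + (γ * l h - Real.log C) / 2 := by
      rw [mul_div_right_comm, Real.log_mul (by positivity) (hρ0 h).ne', hlogρ]
    rw [hlog] at hnle
    have hnN : (n : ℝ) ≤ N h := by
      rw [← ENat.natCast_toNat (hfin h hh.1)] at hn
      simp only [hN]
      exact_mod_cast hn
    calc b * γ / (2 * Real.pi) * l h =
          b' * γ / (2 * Real.pi) * l h - (b' - b) * γ / (2 * Real.pi) * l h := by ring
      _ ≤ b' * γ / (2 * Real.pi) * l h +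
          b' * (Real.log (Real.sqrt δ / R) - Real.log C / 2) / Real.pi - h := by linarith [hh.2]
      _ = (b' * (Real.log (Real.sqrt δ / R) + (γ * l h - Real.log C) / 2) / (Real.pi * h) - 1) *
          h := by
        have := hh.1.ne'
        have := Real.pi_pos.ne'
        field_simp
        ring
      _ ≤ N h * h := mul_le_mul_of_nonneg_right (hnle.trans hnN) hh.1.le
  have hden : ∀ᶠ h in 𝓝[>] 0, 0 < h ∧ 0 < l h ∧
      γ / (4 * Real.pi) * (|Real.log h| / h) = γ / (4 * Real.pi) * l h / h := by
    filter_upwards [hpos] with h hh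
    have h1 : 0 < l h := neg_pos.mpr (Real.log_neg hh.1 hh.2)
    refine ⟨hh.1, h1, ?_⟩
    rw [abs_of_neg (Real.log_neg hh.1 hh.2), mul_div_assoc]
  have hcoef : 0 < γ / (4 * Real.pi) := by have := Real.pi_pos; positivity
  refine isEquivalent_of_tendsto_one (tendsto_order.mpr ⟨fun r hr => ?_, fun r hr => ?_⟩)
  · obtain ⟨b, hb, hb'⟩ := exists_between (max_lt (by linarith : r / 2 < 1 / 2) one_half_pos)
    filter_upwards [hden, hlower b ((le_max_right _ _).trans_lt hb) hb'] with h hd hlow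
    have hrb : r < 2 * b := by linarith [(le_max_left (r / 2) 0).trans_lt hb]
    have hpd : 0 < γ / (4 * Real.pi) * l h := mul_pos hcoef hd.2.1
    rw [Pi.div_apply, hd.2.2, lt_div_iff₀ (div_pos hpd hd.1), ← mul_div_assoc, div_lt_iff₀ hd.1]
    refine lt_of_lt_of_le (mul_lt_mul_of_pos_right hrb hpd) (le_trans (le_of_eq ?_) hlow)
    ring
  · obtain ⟨b, hb, hb'⟩ := exists_between (by linarith : 1 / 2 < r / 2)
    filter_upwards [hden, hupper b hb] with h hd hup
    have hrb : 2 * b < r := by linarith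
    have hpd : 0 < γ / (4 * Real.pi) * l h := mul_pos hcoef hd.2.1
    rw [Pi.div_apply, hd.2.2, div_lt_iff₀ (div_pos hpd hd.1), ← mul_div_assoc, lt_div_iff₀ hd.1]
    refine lt_of_le_of_lt (hup.trans (le_of_eq ?_)) (mul_lt_mul_of_pos_right hrb hpd)
    ring
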